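/- **Conventions.** Let $\omega\in\mathfrak S_n$. Consider the triangular shape of the boxes $(r,c)$ (row $r\ge 1$ from top to bottom, column $c\ge 1$ from left to right) with $r+c\le n+1$. A *filling* places a crossing or a contact in each box with $r+c\le n$ (the boxes with $r+c=n+1$ being contacts). For each $i\in[n]$, pipe $i$ enters from the left in row $i$ and travels east and north: it goes straight at crossings, and at contacts it turns (from west to north, or from south to east), until it exits on top. The filling is a (reduced) *pipe dream* of $\Pi(\omega)$ if any two distinct pipes cross at most once and, for each $i$, pipe $i$ exits in column $\omega^{-1}(i)$. Its *contact graph* on $[n]$ has an arc $i\to j$ for each contact at which pipe $i$ turns from west to north (northwest pipe) and pipe $j$ turns from south to east (southeast pipe). The pipe dream is *acyclic* if this graph has no oriented cycle, and a permutation $\pi\in\mathfrak S_n$ is a *linear extension* of it if $\pi^{-1}(i)<\pi^{-1}(j)$ for every arc $i\to j$. We write $\pi\le\omega$ (weak order) if for all $i<j$, $\pi^{-1}(i)>\pi^{-1}(j)$ implies $\omega^{-1}(i)>\omega^{-1}(j)$. In a partial drawing of pipes, a *free elbow* is a box in which some drawn pipe turns from west to north and no drawn pipe turns from south to east. A *staircase*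 is a set of boxes any two distinct of which are one strictly southwest of the other. If $e_1,\dots,e_k$ is a staircase, listed from southwest to northeast, with $e_i$ in row $r_i$ and column $c_i$, and $j>r_1$ and $c_k<c$ (when $k\ge1$), the pipe entering in row $j$, exiting in column $c$ and *covering* this staircase is the one which turns from south to east exactly at the boxes $(r_i,c_i)$ for $1\le i\le k$, and from west to north exactly at the boxes $(r_{i-1},c_i)$ for $1\le i\le k+1$, where $r_0=j$ and $c_{k+1}=c$. **Proposition.** Let $\pi,\omega\in\mathfrak S_n$ with $\pi\le\omega$ in weak order. There is a unique acyclic pipe dream $P\in\Pi(\omega)$ having $\pi$ as a linear extension. It is constructed by starting from the empty shape and inserting the pipes $\pi(1),\dots,\pi(n)$ one by one, as follows. At step $t$, with $j=\pi(t)$ and $c=\omega^{-1}(\pi(t))$, the currently free elbows in the rectangle $[j]\times[c]$ form a staircase, whose boxes all lie in rows $<j$ and columns $<c$, and one inserts the pipe entering in row $j$, exiting in column $c$, and covering this staircase (so that it turns from south to east exactly at the boxes of this staircase). This pipe is as far northwest as possible: each box of any path going east and north from the entry of row $j$ to the exit of column $c$, and turning from south to east only at currently free elbows, is weakly southeast of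 some box of the inserted pipe. After step $n$, for each $i\in[n]$, the inserted pipe $i$ coincides with the pipe $i$ of $P$. -/

import Mathlib

/-- A box of the grid, as the pair (row, column).  Rows are numbered from top to bottom and columns
from left to right, both starting from `0`; so row `r` and column `c` here are row `r + 1` and column
`c + 1` in the convention that starts from `1`. -/
abbrev Box : Type := ℕ × ℕ

/-- The side of a box through which a pipe arrives in it (pipes go east and north). -/
inductive Side : Type
  | west
  | south

/-- The four ways in which a pipe can go through a box: turning from west to north, going straight
from west to east, turning from south to east, going straight from south to north. -/
inductive Piece : Type
  | westNorth
  | westEast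
  | southEast
  | southNorth

/-- `Arrives A B j s b`: the pipe which enters the grid on the left of row `j`, and which turns north
exactly in the boxes of `A` when it arrives from the west, and turns east exactly in the boxes of `B`
when it arrives from the south, arrives in the box `b` through the side `s`.  (A pipe that goes north
in row `0` leaves the grid.) -/
inductive Arrives (A B : Set Box) (j : ℕ) : Side → Box → Prop
  | enter : Arrives A B j Side.west (j, 0)
  | westNorth (r c : ℕ) : Arrives A B j Side.west (r + 1, c) → (r + 1, c) ∈ A →
      Arrives A B j Side.south (r, c)
  | westEast (r c : ℕ) : Arrives A B j Side.west (r, c) → (r, c) ∉ A →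
      Arrives A B j Side.west (r, c + 1)
  | southEast (r c : ℕ) : Arrives A B j Side.south (r, c) → (r, c) ∈ B →
      Arrives A B j Side.west (r, c + 1)
  | southNorth (r c : ℕ) : Arrives A B j Side.south (r + 1, c) → (r + 1, c) ∉ B →
      Arrives A B j Side.south (r, c)

/-- The pipe which enters the grid on the left of row `j`, turns north exactly in the boxes of `A`
when it arrives from the west, and turns east exactly in the boxes of `B` when it arrives from the
south.  It is recorded as the set of the boxes it visits, with the way in which it goes through
each of them. -/
def tracedPipe (A B : Set Box) (j : ℕ) : Set (Box × Piece) :=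
  {x | match x.2 with
    | Piece.westNorth => Arrives A B j Side.west x.1 ∧ x.1 ∈ A
    | Piece.westEast => Arrives A B j Side.west x.1 ∧ x.1 ∉ A
    | Piece.southEast => Arrives A B j Side.south x.1 ∧ x.1 ∈ B
    | Piece.southNorth => Arrives A B j Side.south x.1 ∧ x.1 ∉ B}

/-- The pipe `p` enters the grid on the left of row `r`. -/
def EntersAt (p : Set (Box × Piece)) (r : ℕ) : Prop :=
  ((r, 0), Piece.westNorth) ∈ p ∨ ((r, 0), Piece.westEast) ∈ p

/-- The pipe `p` exits the grid on the top of column `c`. -/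
def ExitsAt (p : Set (Box × Piece)) (c : ℕ) : Prop :=
  ((0, c), Piece.westNorth) ∈ p ∨ ((0, c), Piece.southNorth) ∈ p

/-- The pipes `p` and `q` cross in the box `b`. -/
def CrossAt (p q : Set (Box × Piece)) (b : Box) : Prop :=
  ((b, Piece.westEast) ∈ p ∧ (b, Piece.southNorth) ∈ q) ∨
    ((b, Piece.southNorth) ∈ p ∧ (b, Piece.westEast) ∈ q)

/-- A filling with crossings and contacts of the triangular shape formed by the boxes `(r, c)` with
`r + c < n`.  It is given by its set of crossings, all other boxes being filled with contacts. The
boxes of the last diagonal `r + c + 1 = n` cannot be crossings: they are only visited by one pipe,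
which arrives from the west and leaves to the north. -/
@[ext]
structure Filling (n : ℕ) where
  crossings : Set Box
  mem_shape : ∀ b ∈ crossings, b.1 + b.2 + 1 < n

namespace Filling

variable {n : ℕ}

/-- The pipe of the filling which enters in row `i`: it goes straight at crossings and it turns at all
other boxes. -/
def pipe (P : Filling n) (i : Fin n) : Set (Box × Piece) :=
  tracedPipe P.crossingsᶜ P.crossingsᶜ i

/-- Any two distinct pipes cross at most once. -/
def IsReduced (P : Filling n) : Prop :=
  ∀ i j : Fin n, i ≠ j → ∀ b b' : Box,
    CrossAt (P.pipe i) (P.pipe j) b → CrossAt (P.pipe i) (P.pipe j) b' → b = b'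

/-- The filling is a reduced pipe dream with exiting permutation `ω` (in one-line notation, `ω` lists
the pipes in the order of their exit points from left to right): the pipe entering in row `i` exits
in column `ω⁻¹ i`. -/
def IsPipeDream (P : Filling n) (ω : Equiv.Perm (Fin n)) : Prop :=
  P.IsReduced ∧ ∀ i : Fin n, ExitsAt (P.pipe i) (ω.symm i)

/-- The arcs of the contact graph: there is a contact at which `i` is the northwest pipe (it turns
from west to north) and `j` is the southeast pipe (it turns from south to east). -/
def ContactArc (P : Filling n) (i j : Fin n) : Prop :=
  ∃ b : Box, (b, Piece.westNorth) ∈ P.pipe i ∧ (b, Piece.southEast) ∈ P.pipe j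

/-- The contact graph has no oriented cycle. -/
def IsAcyclic (P : Filling n) : Prop :=
  ∀ i : Fin n, ¬ Relation.TransGen P.ContactArc i i

/-- `π` is a linear extension of `P`: the tail of any arc of the contact graph appears before its
head in the one-line notation of `π`. -/
def IsLinearExtension (P : Filling n) (π : Equiv.Perm (Fin n)) : Prop :=
  ∀ i j : Fin n, P.ContactArc i j → π.symm i < π.symm j

end Filling

/-- The weak order on permutations (whose covers switch two consecutive entries in one-line notation):
any two values inverted in `π` are also inverted in `ω`. -/
def WeakLE {n : ℕ} (π ω : Equiv.Perm (Fin n)) : Prop :=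
  ∀ i j : Fin n, i < j → π.symm j < π.symm i → ω.symm j < ω.symm i

/-- A staircase: a set of boxes any two of which are one strictly southwest of the other. -/
def IsStaircase (E : Set Box) : Prop :=
  ∀ e ∈ E, ∀ f ∈ E, e ≠ f → (f.1 < e.1 ∧ e.2 < f.2) ∨ (e.1 < f.1 ∧ f.2 < e.2)

/-- The pipe which enters in row `j`, exits in column `c`, and covers the staircase `E`: it goes east
until it reaches the column of the next box of `E` (or column `c` when there is none left), then north
until it reaches this box of `E`, where it turns east again, and so on; it finally goes north in
column `c`. -/
def coveringPipe (j c : ℕ) (E : Set Box) : Set (Box × Piece) :=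
  tracedPipe {b | b.2 = c ∨ ∃ e ∈ E, e.2 = b.2} E j

/-- The currently free elbows of a partial drawing (where `D i` is the pipe `i`, which is empty as
long as it has not been inserted): the boxes where an inserted pipe turns from west to north, and
where no inserted pipe turns from south to east. -/
def freeElbows {n : ℕ} (D : Fin n → Set (Box × Piece)) : Set Box :=
  {b | (∃ i, (b, Piece.westNorth) ∈ D i) ∧ ∀ i, (b, Piece.southEast) ∉ D i}

/-- The currently free elbows in the rectangle formed by the rows up to row `j` and the columns up to
column `c`, row `j` and column `c` included. -/
def freeElbowsIn {n : ℕ} (D : Fin n → Set (Box × Piece)) (j c : ℕ) : Set Box :=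
  {b | b ∈ freeElbows D ∧ b.1 ≤ j ∧ b.2 ≤ c}

/-- The drawing obtained after the first `t` steps of the insertion algorithm. -/
def insertionDrawing {n : ℕ} (π ω : Equiv.Perm (Fin n)) : ℕ → Fin n → Set (Box × Piece)
  | 0 => fun _ => ∅
  | t + 1 =>
    if h : t < n then
      Function.update (insertionDrawing π ω t) (π ⟨t, h⟩)
        (coveringPipe (π ⟨t, h⟩) (ω.symm (π ⟨t, h⟩))
          (freeElbowsIn (insertionDrawing π ω t) (π ⟨t, h⟩) (ω.symm (π ⟨t, h⟩))))
    else insertionDrawing π ω t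

/-! Every step of a pipe, east or north, raises the diagonal index (column minus row) by one. Pipes
can therefore be compared diagonal by diagonal, from northwest to southeast. A contact preserves the
relative order of the two pipes in its box and a crossing reverses it, so two pipes change order
only by crossing (`edgeRank_lt_or_cross`).

Uniqueness. Let `P` be a reduced pipe dream with linear extension `π`. The claim is that, once the
pipes before `j` in `π` are drawn, the free elbows in the rectangle of `j` are exactly the boxes
where `j` turns east. Free elbows strictly southeast of `j` are excluded by `not_southeast`, and
those strictly northwest by `not_northwest`. In both cases an extremal counterexample would force
two pipes to cross twice: once before the elbow and once after it. A pipe is determined by its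
entry, its exit and its turns to the east (`coveringPipe_southEast`), so the insertion algorithm
redraws the pipes of `P`, whichever `P` is chosen. Acyclicity is automatic from the linear
extension.

Existence. Descend in weak order from `ω` to `π`. For `π = ω`, the left-justified filling given by
the inversion code of `ω` works. To exchange two consecutive entries `j i` with `i < j`, only
contacts with `j` northwest of `i` obstruct. The last of them is preceded by the crossing of `i` and
`j`, and exchanging this crossing with this contact removes the obstruction (`exists_swap`).
Reducedness is maintained by counting: each inversion of `ω` forces its own crossing, so a filling
with no more crossings than inversions is reduced (`isReduced_of_ncard_le`). -/

/-- The index of the diagonal of a box, which increases by one at each step of a pipe. -/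
def diag (b : Box) : ℤ := (b.2 : ℤ) - b.1

/-- The rank of an edge among the edges entering the boxes of a diagonal, from northwest to
southeast. -/
def edgeRank : Side → Box → ℕ
  | Side.west, b => 2 * b.1
  | Side.south, b => 2 * b.1 + 1

/-! ### Pipes followed diagonal by diagonal -/

namespace Arrives

variable {A B A' B' : Set Box} {j : ℕ} {s s' : Side} {b b' : Box}

theorem row_le (h : Arrives A B j s b) : b.1 ≤ j := by
  induction h <;> simp_all <;> omega

theorem neg_le_diag (h : Arrives A B j s b) : -(j : ℤ) ≤ diag b := by
  have := h.row_le
  simp only [diag]; omega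

theorem exists_of_le (h : Arrives A B j s b) {t : ℤ} (ht : -(j : ℤ) ≤ t) (ht' : t ≤ diag b) :
    ∃ s' b', Arrives A B j s' b' ∧ diag b' = t ∧ b.1 ≤ b'.1 ∧ b'.2 ≤ b.2 := by
  induction h with
  | enter =>
    refine ⟨_, _, enter, ?_, le_rfl, le_rfl⟩
    simp only [diag] at *; omega
  | westNorth r c h hm ih | southNorth r c h hm ih =>
    by_cases ht1 : t ≤ diag (r + 1, c)
    · obtain ⟨s', b', h1, h2, h3, h4⟩ := ih ht1
      exact ⟨s', b', h1, h2, by simp_all; omega, h4⟩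
    · refine ⟨_, _, by first | exact westNorth r c h hm | exact southNorth r c h hm, ?_, le_rfl,
        le_rfl⟩
      simp only [diag] at *; push_cast at *; omega
  | westEast r c h hm ih | southEast r c h hm ih =>
    by_cases ht1 : t ≤ diag (r, c)
    · obtain ⟨s', b', h1, h2, h3, h4⟩ := ih ht1
      exact ⟨s', b', h1, h2, h3, by simp_all; omega⟩
    · refine ⟨_, _, by first | exact westEast r c h hm | exact southEast r c h hm, ?_, le_rfl,
        le_rfl⟩
      simp only [diag] at *; push_cast at *; omega

/-- The diagonal counts the steps made since the entry, and the trajectory is deterministic. -/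
theorem eq_of_diag_eq (h : Arrives A B j s b) (h' : Arrives A B j s' b')
    (hd : diag b = diag b') : s = s' ∧ b = b' := by
  induction h generalizing s' b' with
  | enter =>
    cases h' with
    | enter => simp
    | westNorth r c h hm | southNorth r c h hm | westEast r c h hm | southEast r c h hm =>
      have := h.neg_le_diag
      simp only [diag] at *; push_cast at *; omega
  | westNorth r c h hm ih | southNorth r c h hm ih | westEast r c h hm ih
  | southEast r c h hm ih =>
    cases h' with
    | enter =>
      have := h.neg_le_diag
      simp only [diag] at *; push_cast at *; omega
    | westNorth r' c' h' hm' | southNorth r' c' h' hm' | westEast r' c' h' hm'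
    | southEast r' c' h' hm' =>
      have := ih h' (by simp only [diag] at *; push_cast at *; omega)
      simp_all

theorem chain (h : Arrives A B j s b) (h' : Arrives A B j s' b') (hd : diag b ≤ diag b') :
    b'.1 ≤ b.1 ∧ b.2 ≤ b'.2 := by
  obtain ⟨s1, b1, h1, h2, h3, h4⟩ := h'.exists_of_le h.neg_le_diag hd
  obtain ⟨-, rfl⟩ := h.eq_of_diag_eq h1 h2.symm
  exact ⟨h3, h4⟩

theorem next_cases (h : Arrives A B j s b) (h' : Arrives A B j s' b')
    (hd : diag b' = diag b + 1) :
    (b' = (b.1, b.2 + 1) ∧ s' = Side.west ∧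
      (s = Side.west ∧ b ∉ A ∨ s = Side.south ∧ b ∈ B)) ∨
    (b = (b'.1 + 1, b'.2) ∧ s' = Side.south ∧
      (s = Side.west ∧ b ∈ A ∨ s = Side.south ∧ b ∉ B)) := by
  cases h' with
  | enter =>
    have := h.neg_le_diag
    simp only [diag] at *; push_cast at *; omega
  | westNorth r c h' hm | southNorth r c h' hm | westEast r c h' hm | southEast r c h' hm =>
    obtain ⟨rfl, rfl⟩ := h.eq_of_diag_eq h' (by simp only [diag] at *; push_cast at *; omega)
    simp_all

theorem exists_next (h : Arrives A B j s b) (hb : 0 < b.1) :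
    ∃ s' b', Arrives A B j s' b' ∧ diag b' = diag b + 1 := by
  obtain ⟨r, c⟩ := b
  obtain ⟨r, rfl⟩ : ∃ r', r = r' + 1 := ⟨r - 1, by simp at hb; omega⟩
  cases s
  · by_cases hA : (r + 1, c) ∈ A
    · exact ⟨_, _, westNorth r c h hA, by simp [diag]; ring⟩
    · exact ⟨_, _, westEast _ c h hA, by simp [diag]; ring⟩
  · by_cases hB : (r + 1, c) ∈ B
    · exact ⟨_, _, southEast _ c h hB, by simp [diag]; ring⟩
    · exact ⟨_, _, southNorth r c h hB, by simp [diag]; ring⟩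

theorem of_congr (h : Arrives A' B' j s b)
    (hA : ∀ b, Arrives A B j Side.west b → (b ∈ A ↔ b ∈ A'))
    (hB : ∀ b, Arrives A B j Side.south b → (b ∈ B ↔ b ∈ B')) : Arrives A B j s b := by
  induction h with
  | enter => exact enter
  | westNorth r c h hm ih => exact westNorth r c ih ((hA _ ih).2 hm)
  | westEast r c h hm ih => exact westEast r c ih (fun h' => hm ((hA _ ih).1 h'))
  | southEast r c h hm ih => exact southEast r c ih ((hB _ ih).2 hm)
  | southNorth r c h hm ih => exact southNorth r c ih (fun h' => hm ((hB _ ih).1 h'))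

theorem congr (h : Arrives A B j s b)
    (hA : ∀ b, Arrives A B j Side.west b → (b ∈ A ↔ b ∈ A'))
    (hB : ∀ b, Arrives A B j Side.south b → (b ∈ B ↔ b ∈ B')) : Arrives A' B' j s b := by
  induction h with
  | enter => exact enter
  | westNorth r c h hm ih => exact westNorth r c ih ((hA _ h).1 hm)
  | westEast r c h hm ih => exact westEast r c ih (fun h' => hm ((hA _ h).2 h'))
  | southEast r c h hm ih => exact southEast r c ih ((hB _ h).1 hm)
  | southNorth r c h hm ih => exact southNorth r c ih (fun h' => hm ((hB _ h).2 h'))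

end Arrives

/-- A traced pipe only depends on the turning boxes among those it visits. -/
theorem tracedPipe_congr {A B A' B' : Set Box} {j : ℕ}
    (hA : ∀ b, Arrives A B j Side.west b → (b ∈ A ↔ b ∈ A'))
    (hB : ∀ b, Arrives A B j Side.south b → (b ∈ B ↔ b ∈ B')) :
    tracedPipe A B j = tracedPipe A' B' j := by
  have key : ∀ s b, Arrives A' B' j s b ↔ Arrives A B j s b :=
    fun s b => ⟨fun h => h.of_congr hA hB, fun h => h.congr hA hB⟩
  ext ⟨b, x⟩
  cases x <;> simp only [tracedPipe, Set.mem_ofPred_eq, key] <;> refine and_congr_right fun h => ?_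
  · exact hA b h
  · exact not_congr (hA b h)
  · exact hB b h
  · exact not_congr (hB b h)

theorem exists_arrives_of_mem_tracedPipe {A B : Set Box} {j : ℕ} {x : Box × Piece}
    (hx : x ∈ tracedPipe A B j) : ∃ s, Arrives A B j s x.1 := by
  obtain ⟨b, x⟩ := x
  cases x <;> exact ⟨_, hx.1⟩

theorem exitsAt_tracedPipe {A B : Set Box} {j c : ℕ} (h : ExitsAt (tracedPipe A B j) c) :
    ∃ s, Arrives A B j s (0, c) := by
  rcases h with h | h
  · exact ⟨_, h.1⟩
  · exact ⟨_, h.1⟩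

/-! ### Pipes of a filling: relative order and crossings -/

namespace Filling

variable {n : ℕ} (P : Filling n)

/-- The pipe `i` of the filling arrives in the box `b` through the side `s`. -/
abbrev Visits (i : Fin n) (s : Side) (b : Box) : Prop :=
  Arrives P.crossingsᶜ P.crossingsᶜ i s b

variable {P} {i j k : Fin n} {s s' : Side} {b b' : Box}

theorem mem_pipe_westNorth :
    (b, Piece.westNorth) ∈ P.pipe i ↔ P.Visits i Side.west b ∧ b ∉ P.crossings := Iff.rfl

theorem mem_pipe_southEast :
    (b, Piece.southEast) ∈ P.pipe i ↔ P.Visits i Side.south b ∧ b ∉ P.crossings := Iff.rfl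

theorem mem_pipe_westEast :
    (b, Piece.westEast) ∈ P.pipe i ↔ P.Visits i Side.west b ∧ b ∈ P.crossings := by
  simp [pipe, tracedPipe]

theorem mem_pipe_southNorth :
    (b, Piece.southNorth) ∈ P.pipe i ↔ P.Visits i Side.south b ∧ b ∈ P.crossings := by
  simp [pipe, tracedPipe]

/-- Pipes can be traced backwards: the type of a box, crossing or contact, determines the incoming
edge from the outgoing one. -/
theorem Visits.injective (h : P.Visits i s b) (h' : P.Visits j s b) : i = j := by
  suffices ∀ (m : ℕ) (s b), Arrives P.crossingsᶜ P.crossingsᶜ m s b →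
      P.Visits j s b → m = j from Fin.ext (this _ _ _ h h')
  clear h h'
  intro m s b h
  induction h with
  | enter => intro h'; cases h'; rfl
  | westNorth r c h hm ih | westEast r c h hm ih | southEast r c h hm ih
  | southNorth r c h hm ih => intro h'; cases h' <;> simp_all

theorem Visits.mem_shape (h : P.Visits i s b) :
    b.1 + b.2 < n ∧ (s = Side.south → b.1 + b.2 + 1 < n) := by
  have hi := i.2
  unfold Visits at h
  induction h with
  | enter => simp
  | westNorth r c h hm ih => simp at ih ⊢; omega
  | westEast r c h hm ih =>
    have := P.mem_shape (r, c) (by simpa using hm)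
    simp at this ⊢; omega
  | southEast r c h hm ih => simp at ih ⊢; omega
  | southNorth r c h hm ih => simp at ih ⊢; omega

variable (P) in
theorem exists_visits : ∀ (r c : ℕ), (r + c < n → ∃ i, P.Visits i Side.west (r, c)) ∧
    (r + c + 1 < n → ∃ i, P.Visits i Side.south (r, c)) := by
  -- Following an edge backwards lowers its diagonal `c - r`; `m` bounds this diagonal, shifted by
  -- `n` to stay nonnegative.
  suffices ∀ (m r c : ℕ), c + n < r + m →
      (r + c < n → ∃ i, P.Visits i Side.west (r, c)) ∧
      (r + c + 1 < n → ∃ i, P.Visits i Side.south (r, c)) from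
    fun r c => this (c + n + 1) r c (by omega)
  intro m
  induction m with
  | zero => intro r c h; constructor <;> intro h' <;> omega
  | succ m ih =>
    intro r c h
    constructor
    · intro hs
      cases c with
      | zero => exact ⟨⟨r, by omega⟩, Arrives.enter⟩
      | succ c =>
        by_cases hc : (r, c) ∈ P.crossings
        · obtain ⟨i, hi⟩ := (ih r c (by omega)).1 (by omega)
          exact ⟨i, Arrives.westEast r c hi (by simpa)⟩
        · obtain ⟨i, hi⟩ := (ih r c (by omega)).2 (by omega)
          exact ⟨i, Arrives.southEast r c hi (by simpa)⟩
    · intro hs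
      by_cases hc : (r + 1, c) ∈ P.crossings
      · have := P.mem_shape _ hc
        obtain ⟨i, hi⟩ := (ih (r + 1) c (by omega)).2 (by simpa using this)
        exact ⟨i, Arrives.southNorth r c hi (by simpa)⟩
      · obtain ⟨i, hi⟩ := (ih (r + 1) c (by omega)).1 (by omega)
        exact ⟨i, Arrives.westNorth r c hi (by simpa)⟩

theorem exists_visits_west (h : b.1 + b.2 < n) : ∃ i, P.Visits i Side.west b :=
  (P.exists_visits b.1 b.2).1 h

theorem exists_visits_south (h : b.1 + b.2 + 1 < n) : ∃ i, P.Visits i Side.south b :=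
  (P.exists_visits b.1 b.2).2 h

variable (P) in
/-- The filling has a crossing in the box `b`, where the pipe `i` is horizontal and the pipe `j` is
vertical. -/
def HorizontalCross (i j : Fin n) (b : Box) : Prop :=
  b ∈ P.crossings ∧ P.Visits i Side.west b ∧ P.Visits j Side.south b

theorem crossAt_iff :
    CrossAt (P.pipe i) (P.pipe j) b ↔ P.HorizontalCross i j b ∨ P.HorizontalCross j i b := by
  simp only [CrossAt, mem_pipe_westEast, mem_pipe_southNorth, HorizontalCross]
  tauto

theorem edgeRank_ne (h : P.Visits i s b) (h' : P.Visits j s' b') (hij : i ≠ j)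
    (hd : diag b = diag b') : edgeRank s b ≠ edgeRank s' b' := by
  intro he
  have hs : s = s' ∧ b = b' := by
    simp only [diag] at hd
    cases s <;> cases s' <;> simp only [edgeRank] at he <;> (try omega) <;>
      exact ⟨rfl, Prod.ext (by omega) (by omega)⟩
  obtain ⟨rfl, rfl⟩ := hs
  exact hij (Visits.injective h h')

/-- Two pipes which do not cross stay in the same order on each diagonal. -/
theorem edgeRank_lt_or_cross {s₁ s₂ s₁' s₂' : Side} {b₁ b₂ b₁' b₂' : Box} (hij : i ≠ j)
    (h₁ : P.Visits i s₁ b₁) (h₂ : P.Visits j s₂ b₂) (hd : diag b₁ = diag b₂)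
    (hlt : edgeRank s₁ b₁ < edgeRank s₂ b₂)
    (h₁' : P.Visits i s₁' b₁') (h₂' : P.Visits j s₂' b₂') (hd' : diag b₁' = diag b₂')
    (hle : diag b₁ ≤ diag b₁') :
    edgeRank s₁' b₁' < edgeRank s₂' b₂' ∨
      ∃ b, P.HorizontalCross i j b ∧ diag b₁ ≤ diag b ∧ diag b < diag b₁' := by
  obtain ⟨m, hm⟩ : ∃ m : ℕ, diag b₁' = diag b₁ + m := ⟨(diag b₁' - diag b₁).toNat, by omega⟩
  induction m generalizing s₁' s₂' b₁' b₂' with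
  | zero =>
    obtain ⟨rfl, rfl⟩ := h₁.eq_of_diag_eq h₁' (by simp at hm; omega)
    obtain ⟨rfl, rfl⟩ := h₂.eq_of_diag_eq h₂' (by simp at hm; omega)
    exact Or.inl hlt
  | succ m ih =>
    obtain ⟨t₁, e₁, g₁, f₁, -⟩ := h₁'.exists_of_le (t := diag b₁ + m)
      (by have := h₁.neg_le_diag; omega) (by push_cast at hm; omega)
    obtain ⟨t₂, e₂, g₂, f₂, -⟩ := h₂'.exists_of_le (t := diag b₁ + m)
      (by have := h₂.neg_le_diag; omega) (by push_cast at hm; omega)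
    rcases ih g₁ g₂ (by omega) (by omega) f₁ with ih | ⟨b, hb, hb1, hb2⟩
    · push_cast at hm
      have n₁ := g₁.next_cases h₁' (by omega)
      have n₂ := g₂.next_cases h₂' (by omega)
      have hne := edgeRank_ne h₁' h₂' hij hd'
      -- Either both pipes are in one box, where only a crossing exchanges them, or their boxes are
      -- in distinct rows and one step cannot exchange them.
      have key : e₁ = e₂ ∧ t₁ = Side.west ∧ t₂ = Side.south ∨ e₁.1 < e₂.1 := by
        cases t₁ <;> cases t₂ <;> simp only [edgeRank] at ih <;>
          simp only [diag] at f₁ f₂ <;> (try (right; omega))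
        by_cases h : e₁.1 = e₂.1
        · left; exact ⟨Prod.ext h (by omega), rfl, rfl⟩
        · right; omega
      rcases key with ⟨rfl, rfl, rfl⟩ | key
      · by_cases hc : e₁ ∈ P.crossings
        · exact Or.inr ⟨e₁, ⟨hc, g₁, g₂⟩, by omega, by omega⟩
        · left
          simp [hc] at n₁ n₂
          obtain ⟨n₁, rfl⟩ := n₁
          obtain ⟨n₂, rfl⟩ := n₂
          have := congrArg Prod.fst n₁
          have := congrArg Prod.fst n₂
          simp only [edgeRank] at *
          omega
      · left
        have k₁ : edgeRank s₁' b₁' ≤ 2 * e₁.1 := by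
          rcases n₁ with ⟨rfl, rfl, -⟩ | ⟨rfl, rfl, -⟩ <;> simp only [edgeRank] <;> omega
        have k₂ : 2 * e₂.1 ≤ edgeRank s₂' b₂' + 1 := by
          rcases n₂ with ⟨rfl, rfl, -⟩ | ⟨rfl, rfl, -⟩ <;> simp only [edgeRank] <;> omega
        omega
    · exact Or.inr ⟨b, hb, hb1, by push_cast at hm; omega⟩

/-- The entry of pipe `i` is the most northwestern edge of its diagonal. -/
theorem edgeRank_enter_lt (hij : i < j) (h : P.Visits j s b) (hd : diag b = -(i : ℤ)) :
    edgeRank Side.west ((i : ℕ), 0) < edgeRank s b := by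
  have hne := edgeRank_ne (P := P) (i := i) (j := j) Arrives.enter h hij.ne (by simp [diag] at *; omega)
  simp only [diag] at hd
  cases s <;> simp only [edgeRank] at * <;> omega

/-- Two pipes `i < j` such that `j` comes before `i` on some diagonal have crossed before. -/
theorem exists_horizontalCross_of_edgeRank_lt (hij : i < j) (h : P.Visits i s b)
    (h' : P.Visits j s' b') (hd : diag b = diag b') (hlt : edgeRank s' b' < edgeRank s b) :
    ∃ e, P.HorizontalCross i j e ∧ diag e < diag b := by
  obtain ⟨t, e, he, hde, -⟩ := h'.exists_of_le (t := -(i : ℤ))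
    (by have : (i : ℕ) < j := hij
        omega) (by have := h.neg_le_diag; omega)
  rcases edgeRank_lt_or_cross hij.ne Arrives.enter he (by simp [diag] at *; omega)
    (edgeRank_enter_lt hij he hde) h h' hd (by have := h.neg_le_diag; simp [diag] at *; omega)
    with h | ⟨e, he, -, h⟩
  · omega
  · exact ⟨e, he, h⟩

/-- Two pipes whose exit points are inverted cross. -/
theorem exists_horizontalCross_of_exitsAt {x y : ℕ} (hij : i < j) (hi : ExitsAt (P.pipe i) x)
    (hj : ExitsAt (P.pipe j) y) (hxy : y < x) : ∃ e, P.HorizontalCross i j e := by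
  obtain ⟨s, hs⟩ := exitsAt_tracedPipe hi
  obtain ⟨t, e, he, hde, -⟩ := hs.exists_of_le (t := (y : ℤ)) (by omega) (by simp [diag]; omega)
  obtain ⟨s', hs'⟩ := exitsAt_tracedPipe hj
  have hne := edgeRank_ne he hs' hij.ne (by simpa [diag] using hde)
  by_cases hlt : edgeRank s' (0, y) < edgeRank t e
  · obtain ⟨e, he, -⟩ := exists_horizontalCross_of_edgeRank_lt hij he hs'
      (by simpa [diag] using hde) hlt
    exact ⟨e, he⟩
  -- Pipe `j` is in row `0`, so `i` can precede it on this diagonal only inside the exit box of `j`.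
  -- There `j` comes from the south and leaves north, so the box is a crossing.
  · have h0 : e = (0, y) ∧ t = Side.west ∧ s' = Side.south := by
      simp only [diag] at hde
      cases t <;> cases s' <;> simp only [edgeRank] at hlt hne <;> try omega
      exact ⟨Prod.ext (by simp; omega) (by simp; omega), rfl, rfl⟩
    obtain ⟨rfl, rfl, rfl⟩ := h0
    refine ⟨_, ?_, he, hs'⟩
    by_contra hc
    rcases hj with hj | hj
    · have := (Arrives.eq_of_diag_eq hj.1 hs' rfl).1
      simp at this
    · exact hj.2 hc

end Filling

/-! ### Exits, turns to the east, and covering pipes -/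

theorem Arrives.edgeRank_next {A B : Set Box} {j : ℕ} {s s' : Side} {b b' : Box}
    (h : Arrives A B j s b) (h' : Arrives A B j s' b') (hd : diag b' = diag b + 1) :
    edgeRank s' b' ≤ 2 * b.1 ∧ 2 * b.1 ≤ edgeRank s' b' + 1 := by
  rcases h.next_cases h' hd with ⟨rfl, rfl, -⟩ | ⟨rfl, rfl, -⟩ <;> simp only [edgeRank] <;> omega

theorem edgeRank_west (b : Box) : edgeRank Side.west b = 2 * b.1 := rfl

theorem le_edgeRank (s : Side) (b : Box) :
    2 * b.1 ≤ edgeRank s b ∧ edgeRank s b ≤ 2 * b.1 + 1 := by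
  cases s <;> simp [edgeRank]

theorem Arrives.exists_of_exitsAt {A B : Set Box} {j x : ℕ}
    (h : ExitsAt (tracedPipe A B j) x) {t : ℤ} (ht : -(j : ℤ) ≤ t) (ht' : t ≤ x) :
    ∃ s b, Arrives A B j s b ∧ diag b = t := by
  obtain ⟨s, hs⟩ := exitsAt_tracedPipe h
  obtain ⟨s', b, h, hd, -⟩ := hs.exists_of_le ht (by simpa [diag] using ht')
  exact ⟨s', b, h, hd⟩

/-- A pipe going further would have to leave `(0, x)` to the east, whereas it leaves this box to the
north. -/
theorem Arrives.diag_le_of_exitsAt {A B : Set Box} {j x : ℕ} {s : Side} {b : Box}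
    (h : ExitsAt (tracedPipe A B j) x) (hb : Arrives A B j s b) : diag b ≤ x := by
  by_contra hlt
  push Not at hlt
  have key : ∀ s, Arrives A B j s (0, x) →
      (s = Side.west ∧ (0, x) ∉ A ∨ s = Side.south ∧ (0, x) ∈ B) := by
    intro s hs
    obtain ⟨s', b', hb', hd', -⟩ := hb.exists_of_le (t := (x : ℤ) + 1)
      (by have := hs.neg_le_diag; simp [diag] at this; omega) (by omega)
    rcases hs.next_cases hb' (by simp [diag] at *; omega) with ⟨-, -, h⟩ | ⟨h, -⟩
    · exact h
    · simp at h
  rcases h with ⟨h1, h2⟩ | ⟨h1, h2⟩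
  · have := key _ h1; simp_all
  · have := key _ h1; simp_all

theorem Arrives.col_le_of_exitsAt {A B : Set Box} {j x : ℕ} {s : Side} {b : Box}
    (h : ExitsAt (tracedPipe A B j) x) (hb : Arrives A B j s b) : b.2 ≤ x := by
  obtain ⟨s', hs'⟩ := exitsAt_tracedPipe h
  exact (hb.chain hs' (by simpa [diag] using hb.diag_le_of_exitsAt h)).2

theorem exitsAt_unique {A B : Set Box} {j x y : ℕ} (hx : ExitsAt (tracedPipe A B j) x)
    (hy : ExitsAt (tracedPipe A B j) y) : x = y := by
  obtain ⟨s, hs⟩ := exitsAt_tracedPipe hx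
  obtain ⟨s', hs'⟩ := exitsAt_tracedPipe hy
  exact le_antisymm (hs.col_le_of_exitsAt hy) (hs'.col_le_of_exitsAt hx)

/-- A pipe going north in a column turns east later in this column, or exits from it. -/
theorem Arrives.exists_southEast {A B : Set Box} {j x r c : ℕ}
    (h : ExitsAt (tracedPipe A B j) x) (hb : Arrives A B j Side.south (r, c)) :
    c = x ∨ ∃ r' ≤ r, ((r', c), Piece.southEast) ∈ tracedPipe A B j := by
  induction r with
  | zero =>
    by_cases hB : (0, c) ∈ B
    · exact Or.inr ⟨0, le_rfl, hb, hB⟩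
    · exact Or.inl (exitsAt_unique (Or.inr ⟨hb, hB⟩) h)
  | succ r ih =>
    by_cases hB : (r + 1, c) ∈ B
    · exact Or.inr ⟨r + 1, le_rfl, hb, hB⟩
    · rcases ih (southNorth r c hb hB) with h | ⟨r', hr', h⟩
      · exact Or.inl h
      · exact Or.inr ⟨r', by omega, h⟩

/-- A pipe going east in a row entered in this row, or turned east earlier in this row. -/
theorem Arrives.exists_southEast_of_west {A B : Set Box} {j r c : ℕ}
    (hb : Arrives A B j Side.west (r, c)) :
    r = j ∨ ∃ c' < c, ((r, c'), Piece.southEast) ∈ tracedPipe A B j := by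
  induction c with
  | zero => cases hb; exact Or.inl rfl
  | succ c ih =>
    cases hb with
    | westEast _ _ h hA =>
      rcases ih h with h | ⟨c', hc', h⟩
      · exact Or.inl h
      · exact Or.inr ⟨c', by omega, h⟩
    | southEast _ _ h hB => exact Or.inr ⟨c, by omega, h, hB⟩

/-- Between two turns to the east, the pipe makes a step east out of the first and a step north into
the second. -/
theorem row_lt_of_southEast {A B : Set Box} {j : ℕ} {b b' : Box}
    (h : (b, Piece.southEast) ∈ tracedPipe A B j) (h' : (b', Piece.southEast) ∈ tracedPipe A B j)
    (hd : diag b < diag b') : b'.1 < b.1 ∧ b.2 < b'.2 := by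
  have hb : Arrives A B j Side.south b := h.1
  have hb' : Arrives A B j Side.south b' := h'.1
  have h1 : Arrives A B j Side.west (b.1, b.2 + 1) := Arrives.southEast b.1 b.2 h.1 h.2
  obtain ⟨s, e, he, hed, -⟩ := hb'.exists_of_le (t := diag b' - 1)
    (by have := hb.neg_le_diag; omega) (by omega)
  have h2 := hb.chain he (by omega)
  have h3 := h1.chain hb' (by simp only [diag] at *; push_cast; omega)
  rcases he.next_cases hb' (by omega) with ⟨-, h, -⟩ | ⟨rfl, -, -⟩
  · simp at h
  · simp only at *
    omega

theorem isStaircase_southEast {A B : Set Box} {j : ℕ} :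
    IsStaircase {b | (b, Piece.southEast) ∈ tracedPipe A B j} := by
  intro e he f hf hne
  rcases lt_trichotomy (diag e) (diag f) with h | h | h
  · exact Or.inl (row_lt_of_southEast he hf h)
  · exact absurd (Arrives.eq_of_diag_eq he.1 hf.1 h).2 hne
  · exact Or.inr (row_lt_of_southEast hf he h)

/-- A pipe is the covering pipe of the staircase of its turns to the east. -/
theorem coveringPipe_southEast {A B : Set Box} {j x : ℕ} (h : ExitsAt (tracedPipe A B j) x) :
    coveringPipe j x {b | (b, Piece.southEast) ∈ tracedPipe A B j} = tracedPipe A B j := by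
  refine (tracedPipe_congr ?_ ?_).symm
  · rintro ⟨r, c⟩ hb
    simp only [Set.mem_ofPred_eq]
    constructor
    · intro hA
      cases r with
      | zero => exact Or.inl (exitsAt_unique (Or.inl ⟨hb, hA⟩) h)
      | succ r =>
        rcases (Arrives.westNorth r c hb hA).exists_southEast h with h | ⟨r', -, h⟩
        · exact Or.inl h
        · exact Or.inr ⟨_, h, rfl⟩
    · intro hc
      by_contra hA
      have h1 := Arrives.westEast r c hb hA
      rcases hc with rfl | ⟨e, he, rfl⟩
      · have := h1.col_le_of_exitsAt h
        simp at this
      · have hne : diag e ≠ diag (r, e.2) := fun hd => by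
          have := (Arrives.eq_of_diag_eq he.1 hb hd).1
          simp at this
        rcases lt_or_ge (diag e) (diag (r, e.2)) with hd | hd
        · have := (Arrives.southEast e.1 e.2 he.1 he.2).chain hb
            (by simp only [diag] at *; push_cast; omega)
          simp at this
        · have := h1.chain he.1 (by simp only [diag] at *; push_cast; omega)
          simp at this
  · intro b hb
    exact ⟨fun hB => ⟨hb, hB⟩, fun hB => hB.2⟩

/-- A path is weakly southeast of any path with the same ends which has more turns to the east. -/
theorem exists_northwest_of_southEast_subset {A B : Set Box} {j x : ℕ} {p : Set (Box × Piece)}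
    (h : ExitsAt (tracedPipe A B j) x) (hj : EntersAt p j) (hx : ExitsAt p x)
    (hp : ∀ b, (b, Piece.southEast) ∈ tracedPipe A B j → (b, Piece.southEast) ∈ p)
    {y : Box × Piece} (hy : y ∈ tracedPipe A B j) : ∃ z ∈ p, z.1.1 ≤ y.1.1 ∧ z.1.2 ≤ y.1.2 := by
  obtain ⟨s, hs⟩ := exists_arrives_of_mem_tracedPipe hy
  obtain ⟨⟨r, c⟩, y⟩ := y
  cases s
  · rcases hs.exists_southEast_of_west with rfl | ⟨c', hc', h'⟩
    · rcases hj with hj | hj <;> exact ⟨_, hj, le_rfl, Nat.zero_le _⟩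
    · exact ⟨_, hp _ h', le_rfl, hc'.le⟩
  · rcases hs.exists_southEast h with rfl | ⟨r', hr', h'⟩
    · rcases hx with hx | hx <;> exact ⟨_, hx, Nat.zero_le _, le_rfl⟩
    · exact ⟨_, hp _ h', hr', le_rfl⟩

/-! ### Reconstruction of a pipe dream from a linear extension -/

namespace Filling

variable {n : ℕ} {P : Filling n} {π ω : Equiv.Perm (Fin n)} {i j k : Fin n} {s s' : Side}
  {b b' : Box}

theorem IsReduced.eq_of_cross (hr : P.IsReduced) (hij : i ≠ j)
    (h : P.HorizontalCross i j b ∨ P.HorizontalCross j i b)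
    (h' : P.HorizontalCross i j b' ∨ P.HorizontalCross j i b') : b = b' :=
  hr i j hij b b' (crossAt_iff.2 h) (crossAt_iff.2 h')

theorem IsLinearExtension.lt_of_contact (hl : P.IsLinearExtension π)
    (hi : P.Visits i Side.west b) (hj : P.Visits j Side.south b) (hb : b ∉ P.crossings) :
    π.symm i < π.symm j :=
  hl i j ⟨b, ⟨hi, hb⟩, ⟨hj, hb⟩⟩

/-- A pipe `i` before `j` in a linear extension has no turn to the north which is southeast of the
pipe `j` and in its rectangle. -/
theorem IsLinearExtension.not_southeast (hl : P.IsLinearExtension π) (hr : P.IsReduced) {x : ℕ}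
    (hx : ExitsAt (P.pipe j) x) (hij : π.symm i < π.symm j) (hb1 : b.1 ≤ j) (hb2 : b.2 ≤ x)
    (hi : P.Visits i Side.west b) (hb : b ∉ P.crossings) (hj : P.Visits j s' b')
    (hd : diag b' = diag b) : ¬ b'.1 < b.1 := by
  -- Induction towards the northwest corner: at a contact where `i` turns east, the other pipe `i'`
  -- precedes `i`, hence `j`, and gives a counterexample closer to the corner.
  obtain ⟨m, hm⟩ : ∃ m, b.1 + b.2 = m := ⟨_, rfl⟩
  induction m using Nat.strong_induction_on generalizing b b' i s' with
  | _ m ih =>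
  intro hlt
  obtain ⟨r, c⟩ := b
  simp only at hb1 hb2 hm hlt
  have hne : i ≠ j := by rintro rfl; exact lt_irrefl _ hij
  -- the pipe `i` crosses `j` after `b` in the column of `b`
  have forward : ∀ r' < r, ∀ s' b', P.Visits i Side.south (r', c) → P.Visits j s' b' →
      diag b' = diag (r', c) → edgeRank s' b' < 2 * r' + 1 →
      ∃ r'' ≤ r', P.HorizontalCross j i (r'', c) := by
    intro r'
    induction r' with
    | zero =>
      intro hr' s' b' hi' hj' hd' hlt'
      obtain ⟨h1, -⟩ := le_edgeRank s' b'
      have hb' : b' = (0, c) := by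
        simp only [diag] at hd'
        exact Prod.ext (by simp; omega) (by simp; omega)
      subst hb'
      -- In row `0` both pipes are in the same box. A contact there would give an arc from `j` to
      -- `i`, against `π`.
      obtain rfl : s' = Side.west := by cases s' <;> simp [edgeRank] at hlt' ⊢
      refine ⟨0, le_rfl, ?_, hj', hi'⟩
      by_contra hc
      exact lt_asymm hij (hl.lt_of_contact hj' hi' hc)
    | succ r' ihr =>
      intro hr' s' b' hi' hj' hd' hlt'
      obtain ⟨i', hi''⟩ := exists_visits_west (P := P) (Visits.mem_shape hi').1
      by_cases hc : (r' + 1, c) ∈ P.crossings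
      · by_cases hj'' : i' = j
        · subst hj''
          exact ⟨r' + 1, le_rfl, hc, hi'', hi'⟩
        · have hlt2 := edgeRank_ne hi'' hj' hj'' hd'.symm
          simp only [edgeRank_west] at hlt2
          have h1 := le_edgeRank s' b'
          obtain ⟨t, e, he, hde⟩ := Arrives.exists_of_exitsAt hx (t := diag (r', c))
            (by simp only [diag]; omega) (by simp only [diag]; omega)
          have h2 := hj'.edgeRank_next he (by simp only [diag] at *; push_cast at *; omega)
          obtain ⟨r'', h3, h4⟩ := ihr (by omega) t e (Arrives.southNorth r' c hi' (by simpa)) he hde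
            (by omega)
          exact ⟨r'', by omega, h4⟩
      · exfalso
        have hi'i := hl.lt_of_contact hi'' hi' hc
        have hj'' : i' ≠ j := by rintro rfl; exact lt_asymm hij hi'i
        have hlt2 := edgeRank_ne hi'' hj' hj'' hd'.symm
        simp only [edgeRank_west] at hlt2
        have h1 := le_edgeRank s' b'
        exact ih (r' + 1 + c) (by omega) (hi'i.trans hij) (by simp only; omega) hb2 hi'' hc hj' hd'
          rfl (by simp only; omega)
  -- the pipe `i` crosses `j` before `b` in the row of `b`
  have backward : ∀ c' ≤ c, ∀ s' b', P.Visits i Side.west (r, c') → P.Visits j s' b' →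
      diag b' = diag (r, c') → b'.1 < r → ∃ c'' < c', P.HorizontalCross i j (r, c'') := by
    intro c'
    induction c' with
    | zero =>
      intro _ s' b' _ _ hd' hlt'
      simp only [diag] at hd'
      omega
    | succ c' ihc =>
      intro hc' s' b' hi' hj' hd' hlt'
      obtain ⟨t, e, he, hde, -⟩ := hj'.exists_of_le (t := diag (r, c'))
        (by simp only [diag]; omega) (by simp only [diag] at *; push_cast at *; omega)
      have h1 := le_edgeRank s' b'
      have h2 := he.edgeRank_next hj' (by simp only [diag] at *; push_cast at *; omega)
      have her : e.1 = r → e = (r, c') := fun h => by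
        simp only [diag] at hde
        exact Prod.ext h (by simp; omega)
      cases hi' with
      | westEast _ _ hi' hc =>
        by_cases h : e.1 = r
        · obtain rfl := her h
          cases t
          · exact absurd (Visits.injective hi' he) hne
          · exact ⟨c', by omega, by simpa using hc, hi', he⟩
        · obtain ⟨c'', h3, h4⟩ := ihc (by omega) t e hi' he hde (by omega)
          exact ⟨c'', by omega, h4⟩
      | southEast _ _ hi' hc =>
        exfalso
        obtain ⟨i', hi''⟩ := exists_visits_west (P := P) (Visits.mem_shape hi').1
        have hi'i := hl.lt_of_contact hi'' hi' hc
        have hj'' : i' ≠ j := by rintro rfl; exact lt_asymm hij hi'i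
        by_cases h : e.1 = r
        · obtain rfl := her h
          cases t
          · exact hj'' (Visits.injective hi'' he)
          · exact hne (Visits.injective hi' he)
        · exact ih (r + c') (by omega) (hi'i.trans hij) hb1 (by simp only; omega) hi'' hc he hde rfl
            (by simp only; omega)
  -- The two crossings lie in row `r + 1` and in a row at most `r`, which contradicts reducedness.
  obtain ⟨r, rfl⟩ : ∃ r', r = r' + 1 := ⟨r - 1, by omega⟩
  obtain ⟨c'', h1, h2⟩ := backward c le_rfl s' b' hi hj hd hlt
  obtain ⟨t, e, he, hde⟩ := Arrives.exists_of_exitsAt hx (t := diag (r, c))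
    (by simp only [diag]; omega) (by simp only [diag]; omega)
  have h3 := hj.edgeRank_next he (by simp only [diag] at *; push_cast at *; omega)
  obtain ⟨r'', h4, h5⟩ := forward r (by omega) t e (Arrives.westNorth r c hi hb) he hde (by omega)
  have := hr.eq_of_cross hne (Or.inl h2) (Or.inr h5)
  simp only [Prod.mk.injEq] at this
  omega

/-- A pipe `k` after `j` in a linear extension has no turn to the east which is northwest of the
pipe `j`. -/
theorem IsLinearExtension.not_northwest (hl : P.IsLinearExtension π) (hr : P.IsReduced)
    (hjk : π.symm j < π.symm k) (hk : P.Visits k Side.south b) (hb : b ∉ P.crossings)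
    (hj : P.Visits j s' b') (hd : diag b' = diag b) : ¬ b.1 < b'.1 := by
  -- Induction in the opposite direction, towards the last diagonal: at a contact where `k` arrives
  -- from the west, the pipe arriving from the south comes later in `π`.
  obtain ⟨m, hm⟩ : ∃ m, b.1 + b.2 + m = n :=
    ⟨n - (b.1 + b.2), by have := hk.mem_shape.1; omega⟩
  induction m using Nat.strong_induction_on generalizing b b' k s' with
  | _ m ih =>
  intro hlt
  obtain ⟨r, c⟩ := b
  have hsh := hk.mem_shape.1
  simp only at hm hlt hsh
  have hne : k ≠ j := by rintro rfl; exact lt_irrefl _ hjk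
  -- the pipe `k` crosses `j` after `b` in the row of `b`
  have forward : ∀ q c', c' + q = n → c < c' → ∀ s' b', P.Visits k Side.west (r, c') →
      P.Visits j s' b' → diag b' = diag (r, c') → 2 * r < edgeRank s' b' →
      ∃ c'' > c, P.HorizontalCross k j (r, c'') := by
    intro q
    induction q with
    | zero =>
      intro c' hq _ s' b' hk' _ _ _
      have := hk'.mem_shape.1
      simp only at this
      omega
    | succ q ihq =>
      intro c' hq hc' s' b' hk' hj' hd' hlt'
      have h1 := le_edgeRank s' b'
      by_cases h : b'.1 = r
      · obtain rfl : b' = (r, c') := by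
          simp only [diag] at hd'
          exact Prod.ext h (by simp; omega)
        cases s'
        · simp [edgeRank] at hlt'
        · refine ⟨c', hc', ?_, hk', hj'⟩
          by_contra hc
          exact lt_asymm hjk (hl.lt_of_contact hk' hj' hc)
      · have hshj := hj'.mem_shape.1
        by_cases hc : (r, c') ∈ P.crossings
        · obtain ⟨t, e, he, hde⟩ := hj'.exists_next (by omega)
          have h2 := hj'.edgeRank_next he hde
          exact ihq (c' + 1) (by omega) (by omega) t e (Arrives.westEast r c' hk' (by simpa)) he
            (by simp only [diag] at *; push_cast at *; omega) (by omega)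
        · exfalso
          obtain ⟨k', hk''⟩ := exists_visits_south (P := P) (b := (r, c'))
            (by simp only [diag] at *; omega)
          have hkk' := hl.lt_of_contact hk' hk'' hc
          exact ih (n - (r + c')) (by omega) (hjk.trans hkk') hk'' hc hj' hd'
            (by simp only [diag] at *; omega) (by simp only; omega)
  -- the pipe `k` crosses `j` before `b` in the column of `b`
  have backward : ∀ q r', r' + q = n → r ≤ r' → ∀ s' b', P.Visits k Side.south (r', c) →
      P.Visits j s' b' → diag b' = diag (r', c) → r' < b'.1 →
      ∃ r'' > r, P.HorizontalCross j k (r'', c) := by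
    intro q
    induction q with
    | zero =>
      intro r' hq _ s' b' hk' _ _ _
      have := hk'.mem_shape.1
      simp only at this
      omega
    | succ q ihq =>
      intro r' hq hr' s' b' hk' hj' hd' hlt'
      have h1 := le_edgeRank s' b'
      have hbj := hj'.row_le
      obtain ⟨t, e, he, hde, -⟩ := hj'.exists_of_le (t := diag (r' + 1, c))
        (by simp only [diag] at *; push_cast; omega)
        (by simp only [diag] at *; push_cast at *; omega)
      have h2 := he.edgeRank_next hj' (by simp only [diag] at *; push_cast at *; omega)
      have her : e.1 = r' + 1 → e = (r' + 1, c) := fun h => by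
        simp only [diag] at hde
        push_cast at hde
        exact Prod.ext h (by simp; omega)
      cases hk' with
      | southNorth _ _ hk' hc =>
        by_cases h : e.1 = r' + 1
        · obtain rfl := her h
          cases t
          · exact ⟨r' + 1, by omega, by simpa using hc, he, hk'⟩
          · exact absurd (Visits.injective hk' he) hne
        · exact ihq (r' + 1) (by omega) (by omega) t e hk' he hde (by omega)
      | westNorth _ _ hk' hc =>
        exfalso
        by_cases h : e.1 = r' + 1
        · obtain rfl := her h
          cases t
          · exact hne (Visits.injective hk' he)
          · exact lt_asymm hjk (hl.lt_of_contact hk' he hc)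
        · have hsh := (Visits.mem_shape he).1
          obtain ⟨k', hk''⟩ := exists_visits_south (P := P) (b := (r' + 1, c))
            (by simp only [diag] at *; push_cast at *; omega)
          have hkk' := hl.lt_of_contact hk' hk'' hc
          exact ih (n - (r' + 1 + c)) (by omega) (hjk.trans hkk') hk'' hc he hde
            (by simp only [diag] at *; push_cast at *; omega) (by simp only; omega)
  obtain ⟨r'', h1, h2⟩ := backward (n - r) r (by omega) le_rfl s' b' hk hj hd hlt
  obtain ⟨t, e, he, hde⟩ := hj.exists_next (by omega)
  have h3 := hj.edgeRank_next he hde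
  obtain ⟨c'', h4, h5⟩ := forward (n - (c + 1)) (c + 1)
    (by omega) (by omega) t e
    (Arrives.southEast r c hk hb) he (by simp only [diag] at *; push_cast at *; omega) (by omega)
  have := hr.eq_of_cross hne (Or.inl h5) (Or.inr h2)
  simp only [Prod.mk.injEq] at this
  omega

variable (P π) in
/-- The drawing of the pipes of the filling among the first `t` values of `π`. -/
def partialDrawing (t : ℕ) (i : Fin n) : Set (Box × Piece) :=
  {x | (π.symm i : ℕ) < t ∧ x ∈ P.pipe i}

/-- The free elbows in the rectangle of a pipe, once the pipes before it have been drawn, are its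
turns to the east. -/
theorem freeElbowsIn_partialDrawing (hl : P.IsLinearExtension π) (hr : P.IsReduced) {x : ℕ}
    (hx : ExitsAt (P.pipe j) x) :
    freeElbowsIn (P.partialDrawing π (π.symm j)) j x =
      {b | (b, Piece.southEast) ∈ P.pipe j} := by
  ext b
  simp only [freeElbowsIn, freeElbows, partialDrawing, Set.mem_ofPred_eq, Fin.val_fin_lt,
    mem_pipe_westNorth, mem_pipe_southEast]
  constructor
  · rintro ⟨⟨⟨i, hij, hi, hb⟩, hfree⟩, hb1, hb2⟩
    obtain ⟨t, e, he, hde⟩ := Arrives.exists_of_exitsAt hx (t := diag b)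
      (by simp only [diag]; omega) (by simp only [diag]; omega)
    -- Here `e` is the box of `j` on the diagonal of `b`. It cannot be strictly northwest of `b`. If
    -- it were strictly southeast, the pipe `k` turning east at `b`, undrawn because `b` is free,
    -- would contradict `not_northwest`.
    have h1 := hl.not_southeast hr hx hij hb1 hb2 hi hb he hde
    rcases lt_or_eq_of_le (not_lt.1 h1) with h2 | h2
    · exfalso
      have hsh := (Visits.mem_shape he).1
      obtain ⟨k, hk⟩ := exists_visits_south (P := P) (b := b) (by simp only [diag] at *; omega)
      have hkj : k ≠ j := by
        rintro rfl
        have := (hk.eq_of_diag_eq he hde.symm).2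
        subst this
        exact lt_irrefl _ h2
      refine hl.not_northwest hr ?_ hk hb he hde h2
      refine lt_of_le_of_ne (not_lt.1 fun h => hfree k ⟨h, hk, hb⟩) ?_
      exact fun h => hkj (π.symm.injective h).symm
    · obtain rfl : e = b := by
        simp only [diag] at hde
        exact Prod.ext h2.symm (by omega)
      cases t
      · exact absurd hij (by rw [Visits.injective hi he]; exact lt_irrefl _)
      · exact ⟨he, hb⟩
  · rintro ⟨hj, hb⟩
    obtain ⟨i, hi⟩ := exists_visits_west (P := P) hj.mem_shape.1
    refine ⟨⟨⟨i, hl.lt_of_contact hi hj hb, hi, hb⟩, ?_⟩, hj.row_le, hj.col_le_of_exitsAt hx⟩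
    rintro k ⟨hk, hk', -⟩
    rw [Visits.injective hk' hj] at hk
    exact lt_irrefl _ hk

theorem insertionDrawing_eq (hP : P.IsPipeDream ω) (hl : P.IsLinearExtension π) (t : ℕ) :
    t ≤ n → insertionDrawing π ω t = P.partialDrawing π t := by
  induction t with
  | zero =>
    intro _
    funext i
    simp [insertionDrawing, partialDrawing]
  | succ t ih =>
    intro ht
    have hx := hP.2 (π ⟨t, ht⟩)
    have hE := freeElbowsIn_partialDrawing hl hP.1 hx
    simp only [Equiv.symm_apply_apply] at hE
    have hc : coveringPipe (π ⟨t, ht⟩) (ω.symm (π ⟨t, ht⟩))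
        {b | (b, Piece.southEast) ∈ P.pipe (π ⟨t, ht⟩)} = P.pipe (π ⟨t, ht⟩) :=
      coveringPipe_southEast hx
    rw [insertionDrawing, dif_pos (show t < n from ht), ih (by omega), hE, hc]
    funext i
    by_cases hi : i = π ⟨t, ht⟩
    · subst hi
      simp [partialDrawing]
    · rw [Function.update_of_ne hi]
      have : (π.symm i : ℕ) ≠ t := fun h => hi (by
        rw [← Equiv.symm_apply_eq]; exact Fin.ext h)
      ext x
      simp only [partialDrawing, Set.mem_ofPred_eq]
      exact and_congr_left fun _ => by omega

theorem insertionDrawing_eq_pipe (hP : P.IsPipeDream ω) (hl : P.IsLinearExtension π) (i : Fin n) :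
    insertionDrawing π ω n i = P.pipe i := by
  rw [insertionDrawing_eq hP hl n le_rfl]
  simp [partialDrawing]

theorem eq_of_pipe_eq {Q : Filling n} (h : ∀ i, P.pipe i = Q.pipe i) : P = Q := by
  suffices ∀ {P Q : Filling n}, (∀ i, P.pipe i = Q.pipe i) → P.crossings ⊆ Q.crossings from
    Filling.ext (Set.Subset.antisymm (this h) (this fun i => (h i).symm))
  intro P Q h b hb
  have := P.mem_shape b hb
  obtain ⟨i, hi⟩ := exists_visits_west (P := P) (b := b) (by omega)
  have h1 : (b, Piece.westEast) ∈ P.pipe i := mem_pipe_westEast.2 ⟨hi, hb⟩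
  rw [h i] at h1
  exact (mem_pipe_westEast.1 h1).2

theorem IsLinearExtension.isAcyclic (hl : P.IsLinearExtension π) : P.IsAcyclic := by
  intro i hi
  have : ∀ k, Relation.TransGen P.ContactArc i k → π.symm i < π.symm k := by
    intro k hk
    induction hk with
    | single h => exact hl _ _ h
    | tail _ h ih => exact ih.trans (hl _ _ h)
  exact lt_irrefl _ (this i hi)

end Filling

/-! ### Inversions and reducedness by counting -/

theorem finite_shape (n : ℕ) : {b : Box | b.1 + b.2 < n}.Finite :=
  ((Set.finite_Iio n).prod (Set.finite_Iio n)).subset fun b hb => by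
    simp only [Set.mem_ofPred_eq] at hb
    exact ⟨by simp only [Set.mem_Iio]; omega, by simp only [Set.mem_Iio]; omega⟩

/-- The inversions of a permutation, as the pairs of its values. -/
def inversions {n : ℕ} (ω : Equiv.Perm (Fin n)) : Set (Fin n × Fin n) :=
  {p | p.1 < p.2 ∧ ω.symm p.2 < ω.symm p.1}

/-- No value lies strictly between two consecutive ones, so exchanging them affects only their own
comparison. -/
theorem lt_of_lt_swap {n : ℕ} {p : Equiv.Perm (Fin n)} {i j a d : Fin n}
    (hij : (p i : ℕ) + 1 = p j) (h : p a < p d) (hne : ¬ (a = i ∧ d = j)) :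
    p (Equiv.swap i j a) < p (Equiv.swap i j d) := by
  have inj : ∀ {u v : Fin n}, u ≠ v → (p u : ℕ) ≠ p v :=
    fun huv h => huv (p.injective (Fin.ext h))
  have hij' : i ≠ j := by rintro rfl; omega
  rw [Fin.lt_def] at h ⊢
  by_cases ai : a = i
  · subst ai
    have dj : d ≠ j := fun h => hne ⟨rfl, h⟩
    have da : d ≠ a := by rintro rfl; omega
    have := inj dj
    rw [Equiv.swap_apply_left, Equiv.swap_apply_of_ne_of_ne da dj]
    omega
  by_cases aj : a = j
  · subst aj
    have di : d ≠ i := by rintro rfl; omega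
    have da : d ≠ a := by rintro rfl; omega
    rw [Equiv.swap_apply_right, Equiv.swap_apply_of_ne_of_ne di da]
    omega
  have := inj ai
  have := inj aj
  rw [Equiv.swap_apply_of_ne_of_ne ai aj]
  by_cases di : d = i
  · subst di
    rw [Equiv.swap_apply_left]
    omega
  by_cases dj : d = j
  · subst dj
    rw [Equiv.swap_apply_right]
    omega
  rwa [Equiv.swap_apply_of_ne_of_ne di dj]

namespace Filling

variable {n : ℕ} {P : Filling n} {π ω : Equiv.Perm (Fin n)} {i j k : Fin n} {s : Side}
  {b b₁ b₂ : Box}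

theorem finite_crossings (P : Filling n) : P.crossings.Finite :=
  (finite_shape n).subset fun b hb => by
    have := P.mem_shape b hb
    simp only [Set.mem_ofPred_eq]; omega

/-- A filling with at most as many crossings as its exiting permutation has inversions is reduced. -/
theorem isReduced_of_ncard_le (hx : ∀ i, ExitsAt (P.pipe i) (ω.symm i))
    (hc : P.crossings.ncard ≤ (inversions ω).ncard) : P.IsReduced := by
  have hf : ∀ p : Fin n × Fin n, ∃ b, p ∈ inversions ω → P.HorizontalCross p.1 p.2 b := by
    intro p
    by_cases hp : p ∈ inversions ω
    · obtain ⟨b, hb⟩ := exists_horizontalCross_of_exitsAt hp.1 (hx p.1) (hx p.2) hp.2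
      exact ⟨b, fun _ => hb⟩
    · exact ⟨(0, 0), fun h => absurd h hp⟩
  choose f hf using hf
  have hinj : Set.InjOn f (inversions ω) := by
    intro p hp q hq hpq
    have h1 := hf p hp
    have h2 := hf q hq
    rw [← hpq] at h2
    exact Prod.ext (Visits.injective h1.2.1 h2.2.1) (Visits.injective h1.2.2 h2.2.2)
  -- Distinct inversions have distinct crossings, so the bound on their number leaves no other
  -- crossing.
  have himg : f '' inversions ω = P.crossings := by
    refine Set.eq_of_subset_of_ncard_le ?_ ?_ P.finite_crossings
    · rintro _ ⟨p, hp, rfl⟩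
      exact (hf p hp).1
    · rwa [hinj.ncard_image]
  have key : ∀ {i j b}, P.HorizontalCross i j b → i < j ∧ b = f (i, j) := by
    intro i j b h
    have hb := h.1
    rw [← himg] at hb
    obtain ⟨p, hp, rfl⟩ := hb
    have h1 := hf p hp
    obtain rfl := Visits.injective h1.2.1 h.2.1
    obtain rfl := Visits.injective h1.2.2 h.2.2
    exact ⟨hp.1, rfl⟩
  intro i j hij b b' hb hb'
  rw [crossAt_iff] at hb hb'
  rcases hb with hb | hb <;> rcases hb' with hb' | hb' <;>
    have h1 := key hb <;> have h2 := key hb'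
  · rw [h1.2, h2.2]
  · exact absurd h1.1 (lt_asymm h2.1)
  · exact absurd h1.1 (lt_asymm h2.1)
  · rw [h1.2, h2.2]

/-! ### Flips -/

theorem visits_east {r c : ℕ} (h : P.Visits k s (r, c))
    (hs : s = Side.west ↔ (r, c) ∈ P.crossings) : P.Visits k Side.west (r, c + 1) := by
  cases s
  · exact Arrives.westEast r c h (by simpa using hs)
  · exact Arrives.southEast r c h (by simpa using hs)

theorem visits_north {r c : ℕ} (h : P.Visits k s (r + 1, c))
    (hs : s = Side.west ↔ (r + 1, c) ∉ P.crossings) : P.Visits k Side.south (r, c) := by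
  cases s
  · exact Arrives.westNorth r c h (by simpa using hs)
  · exact Arrives.southNorth r c h (by simpa using hs)

variable (P) in
/-- The filling obtained by turning the crossing `b₁` into a contact and the contact `b₂` into a
crossing. -/
def flip (b₁ b₂ : Box) (h : b₂.1 + b₂.2 + 1 < n) : Filling n where
  crossings := insert b₂ (P.crossings \ {b₁})
  mem_shape := by
    rintro b (rfl | hb)
    · exact h
    · exact P.mem_shape b hb.1

/-- The permutation of the pipes `i` and `j` strictly after the box `b₁` and until the box `b₂`. -/
def flipPerm (i j : Fin n) (b₁ b₂ b : Box) : Equiv.Perm (Fin n) :=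
  if diag b₁ < diag b ∧ diag b ≤ diag b₂ then Equiv.swap i j else 1

theorem flipPerm_mem (h : k = i ∨ k = j) (b : Box) :
    flipPerm i j b₁ b₂ b k = i ∨ flipPerm i j b₁ b₂ b k = j := by
  unfold flipPerm
  split_ifs <;> rcases h with rfl | rfl <;> simp

theorem flipPerm_of_ne (hi : k ≠ i) (hj : k ≠ j) (b : Box) : flipPerm i j b₁ b₂ b k = k := by
  unfold flipPerm
  split_ifs
  · exact Equiv.swap_apply_of_ne_of_ne hi hj
  · rfl

theorem flipPerm_left : flipPerm i j b₁ b₂ b₁ = 1 := by simp [flipPerm]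

theorem flipPerm_after_right {b' : Box} (hd : diag b₂ < diag b') :
    flipPerm i j b₁ b₂ b' = 1 := by
  rw [flipPerm, if_neg (by omega)]

/-- Pipes `i` and `j` cross in the box `b₁` and later have a contact, with `j` on the west and `i` on
the south, in the box `b₂`. -/
structure CrossThenContact (P : Filling n) (i j : Fin n) (b₁ b₂ : Box) : Prop where
  diag_lt : diag b₁ < diag b₂
  cross : P.HorizontalCross i j b₁
  west : P.Visits j Side.west b₂
  south : P.Visits i Side.south b₂
  contact : b₂ ∉ P.crossings

namespace CrossThenContact

variable (h : CrossThenContact P i j b₁ b₂)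
include h

theorem shape : b₂.1 + b₂.2 + 1 < n := h.south.mem_shape.2 rfl

theorem ne : b₁ ≠ b₂ := by
  rintro rfl
  exact lt_irrefl _ h.diag_lt

theorem eq_of_diag_eq_left (hk : k = i ∨ k = j) (hb : P.Visits k s b) (hd : diag b = diag b₁) :
    b = b₁ := by
  rcases hk with rfl | rfl
  · exact (hb.eq_of_diag_eq h.cross.2.1 hd).2
  · exact (hb.eq_of_diag_eq h.cross.2.2 hd).2

theorem eq_of_diag_eq_right (hk : k = i ∨ k = j) (hb : P.Visits k s b) (hd : diag b = diag b₂) :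
    b = b₂ := by
  rcases hk with rfl | rfl
  · exact (hb.eq_of_diag_eq h.south hd).2
  · exact (hb.eq_of_diag_eq h.west hd).2

theorem flipPerm_next {b' : Box} (hb : P.Visits (flipPerm i j b₁ b₂ b k) s b)
    (hd : diag b' = diag b + 1) (hne₁ : b ≠ b₁) (hne₂ : b ≠ b₂) :
    flipPerm i j b₁ b₂ b' k = flipPerm i j b₁ b₂ b k := by
  by_cases hk : k = i ∨ k = j
  · have hk' := flipPerm_mem (b₁ := b₁) (b₂ := b₂) hk b
    have h₁ : diag b ≠ diag b₁ := fun h' => hne₁ (h.eq_of_diag_eq_left hk' hb h')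
    have h₂ : diag b ≠ diag b₂ := fun h' => hne₂ (h.eq_of_diag_eq_right hk' hb h')
    have : (diag b₁ < diag b' ∧ diag b' ≤ diag b₂) ↔ (diag b₁ < diag b ∧ diag b ≤ diag b₂) := by
      omega
    unfold flipPerm
    simp only [this]
  · push Not at hk
    rw [flipPerm_of_ne hk.1 hk.2, flipPerm_of_ne hk.1 hk.2]

theorem flipPerm_right : flipPerm i j b₁ b₂ b₂ = Equiv.swap i j := by simp [flipPerm, h.diag_lt]

theorem flipPerm_after_left {b' : Box} (hd : diag b' = diag b₁ + 1) :
    flipPerm i j b₁ b₂ b' = Equiv.swap i j := by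
  have := h.diag_lt
  rw [flipPerm, if_pos (by omega)]

theorem mem_flip (hne₁ : b ≠ b₁) (hne₂ : b ≠ b₂) :
    b ∈ (P.flip b₁ b₂ h.shape).crossings ↔ b ∈ P.crossings := by
  simp [flip, hne₁, hne₂]

theorem left_notMem_flip : b₁ ∉ (P.flip b₁ b₂ h.shape).crossings := by
  simp [flip, h.ne]

theorem right_mem_flip : b₂ ∈ (P.flip b₁ b₂ h.shape).crossings := by
  simp [flip]

theorem flip_east {r c : ℕ} (hb : P.Visits (flipPerm i j b₁ b₂ (r, c) k) s (r, c))
    (hs : s = Side.west ↔ (r, c) ∈ (P.flip b₁ b₂ h.shape).crossings) :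
    P.Visits (flipPerm i j b₁ b₂ (r, c + 1) k) Side.west (r, c + 1) := by
  have hd : diag (r, c + 1) = diag (r, c) + 1 := by simp only [diag]; push_cast; ring
  by_cases h₁ : (r, c) = b₁
  · subst h₁
    obtain rfl : s = Side.south := by
      have := h.left_notMem_flip
      cases s <;> simp_all
    rw [flipPerm_left, Equiv.Perm.one_apply] at hb
    obtain rfl := Visits.injective hb h.cross.2.2
    rw [h.flipPerm_after_left hd, Equiv.swap_apply_right]
    exact visits_east h.cross.2.1 (by simpa using h.cross.1)
  by_cases h₂ : (r, c) = b₂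
  · subst h₂
    obtain rfl : s = Side.west := hs.2 h.right_mem_flip
    rw [h.flipPerm_right] at hb
    have hk := Visits.injective hb h.west
    rw [Equiv.swap_apply_eq_iff, Equiv.swap_apply_right] at hk
    rw [flipPerm_after_right (by omega), hk]
    exact visits_east h.south (by simpa using h.contact)
  · rw [h.flipPerm_next hb hd h₁ h₂]
    exact visits_east hb (by rw [hs, h.mem_flip h₁ h₂])

theorem flip_north {r c : ℕ} (hb : P.Visits (flipPerm i j b₁ b₂ (r + 1, c) k) s (r + 1, c))
    (hs : s = Side.west ↔ (r + 1, c) ∉ (P.flip b₁ b₂ h.shape).crossings) :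
    P.Visits (flipPerm i j b₁ b₂ (r, c) k) Side.south (r, c) := by
  have hd : diag (r, c) = diag (r + 1, c) + 1 := by simp only [diag]; push_cast; ring
  by_cases h₁ : (r + 1, c) = b₁
  · subst h₁
    obtain rfl : s = Side.west := hs.2 h.left_notMem_flip
    rw [flipPerm_left, Equiv.Perm.one_apply] at hb
    obtain rfl := Visits.injective hb h.cross.2.1
    rw [h.flipPerm_after_left hd, Equiv.swap_apply_left]
    exact visits_north h.cross.2.2 (by simpa using h.cross.1)
  by_cases h₂ : (r + 1, c) = b₂
  · subst h₂
    obtain rfl : s = Side.south := by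
      have := h.right_mem_flip
      cases s <;> simp_all
    rw [h.flipPerm_right] at hb
    have hk := Visits.injective hb h.south
    rw [Equiv.swap_apply_eq_iff, Equiv.swap_apply_left] at hk
    rw [flipPerm_after_right (by omega), hk]
    exact visits_north h.west (by simpa using h.contact)
  · rw [h.flipPerm_next hb hd h₁ h₂]
    exact visits_north hb (by rw [hs, h.mem_flip h₁ h₂])

/-- A flip leaves the network of strands intact and only exchanges the labels `i` and `j` on the
portion between the two boxes. -/
theorem visits_of_visits_flip (hb : (P.flip b₁ b₂ h.shape).Visits k s b) :
    P.Visits (flipPerm i j b₁ b₂ b k) s b := by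
  unfold Visits at hb
  induction hb with
  | enter =>
    suffices flipPerm i j b₁ b₂ ((k : ℕ), 0) k = k by
      rw [this]
      exact Arrives.enter
    by_cases hk : k = i ∨ k = j
    · have : diag ((k : ℕ), 0) ≤ diag b₁ := by
        have h' : -(k : ℤ) ≤ diag b₁ := by
          rcases hk with rfl | rfl
          · exact h.cross.2.1.neg_le_diag
          · exact h.cross.2.2.neg_le_diag
        simpa [diag] using h'
      rw [flipPerm, if_neg (by omega), Equiv.Perm.one_apply]
    · push Not at hk
      exact flipPerm_of_ne hk.1 hk.2 _
  | westNorth r c _ hm ih => exact h.flip_north ih (by simpa using hm)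
  | westEast r c _ hm ih => exact h.flip_east ih (by simpa using hm)
  | southEast r c _ hm ih => exact h.flip_east ih (by simpa using hm)
  | southNorth r c _ hm ih => exact h.flip_north ih (by simpa using hm)

/-- The edge is used by some pipe of the flipped filling, and the previous lemma identifies it. -/
theorem visits_flip (hb : P.Visits (flipPerm i j b₁ b₂ b k) s b) :
    (P.flip b₁ b₂ h.shape).Visits k s b := by
  obtain ⟨k', hk'⟩ : ∃ k', (P.flip b₁ b₂ h.shape).Visits k' s b := by
    cases s
    · exact exists_visits_west hb.mem_shape.1
    · exact exists_visits_south (hb.mem_shape.2 rfl)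
  have := Visits.injective hb (h.visits_of_visits_flip hk')
  rwa [(flipPerm i j b₁ b₂ b).injective this]

theorem exitsAt_flip {x : ℕ} (hx : ExitsAt (P.pipe k) x) :
    ExitsAt ((P.flip b₁ b₂ h.shape).pipe k) x := by
  have hx' : ExitsAt (tracedPipe P.crossingsᶜ P.crossingsᶜ k) x := hx
  have hd : diag (0, x) = x := by simp [diag]
  obtain ⟨s, hs⟩ : ∃ s, P.Visits k s (0, x) ∧ (s = Side.west ↔ (0, x) ∉ P.crossings) := by
    rcases hx with hx | hx
    · exact ⟨Side.west, hx.1, by simpa using hx.2⟩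
    · exact ⟨Side.south, hx.1, by simpa using hx.2⟩
  suffices ∃ s, (P.flip b₁ b₂ h.shape).Visits k s (0, x) ∧
      (s = Side.west ↔ (0, x) ∉ (P.flip b₁ b₂ h.shape).crossings) by
    obtain ⟨s, h1, h2⟩ := this
    cases s
    · exact Or.inl (mem_pipe_westNorth.2 ⟨h1, by simpa using h2⟩)
    · exact Or.inr (mem_pipe_southNorth.2 ⟨h1, by simpa using h2⟩)
  have hle : k = i ∨ k = j → diag b₂ ≤ x := by
    rintro (rfl | rfl)
    · exact h.south.diag_le_of_exitsAt hx'
    · exact h.west.diag_le_of_exitsAt hx'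
  have hlt := h.diag_lt
  -- If the contact is in the exit box, the labels are still exchanged when entering it, and the new
  -- crossing restores the exit.
  by_cases h₂ : (0, x) = b₂
  · subst h₂
    obtain rfl : s = Side.west := hs.2.2 h.contact
    obtain rfl := Visits.injective hs.1 h.west
    refine ⟨Side.south, h.visits_flip ?_, by simpa using h.right_mem_flip⟩
    rw [h.flipPerm_right, Equiv.swap_apply_right]
    exact h.south
  · have h₁ : (0, x) ≠ b₁ := by
      rintro rfl
      have hk : k = i ∨ k = j := by
        cases s
        · exact Or.inl (Visits.injective hs.1 h.cross.2.1)
        · exact Or.inr (Visits.injective hs.1 h.cross.2.2)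
      have := hle hk
      omega
    refine ⟨s, h.visits_flip ?_, by rw [hs.2, h.mem_flip h₁ h₂]⟩
    by_cases hk : k = i ∨ k = j
    · have := hle hk
      have hne : diag (0, x) ≠ diag b₂ := fun h' => h₂ (h.eq_of_diag_eq_right hk hs.1 h')
      rw [flipPerm_after_right (by omega)]
      exact hs.1
    · push Not at hk
      rw [flipPerm_of_ne hk.1 hk.2]
      exact hs.1

theorem ncard_flip : (P.flip b₁ b₂ h.shape).crossings.ncard = P.crossings.ncard :=
  Set.ncard_exchange h.contact h.cross.1

end CrossThenContact

/-! ### Exchanging two consecutive entries of the linear extension -/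

variable (P π ω) in
/-- A filling with exiting permutation `ω`, with at most as many crossings as `ω` has inversions, and
having `π` as a linear extension. -/
structure IsMinimalDream : Prop where
  exitsAt : ∀ i, ExitsAt (P.pipe i) (ω.symm i)
  ncard_le : P.crossings.ncard ≤ (inversions ω).ncard
  linear : P.IsLinearExtension π

theorem IsMinimalDream.isReduced (h : P.IsMinimalDream π ω) : P.IsReduced :=
  isReduced_of_ncard_le h.exitsAt h.ncard_le

/-- From a minimal pipe dream with linear extension `… j i …`, where `i < j`, one obtains one with
linear extension `… i j …`, by flipping if necessary the last contact between `i` and `j`. -/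
theorem IsMinimalDream.exists_swap (h : P.IsMinimalDream π ω) (hij : i < j)
    (hπ : (π.symm j : ℕ) + 1 = π.symm i) :
    ∃ Q : Filling n, Q.IsMinimalDream (Equiv.swap i j * π) ω := by
  have hswap : ∀ {a d : Fin n}, π.symm a < π.symm d → ¬ (a = j ∧ d = i) →
      π.symm (Equiv.swap i j a) < π.symm (Equiv.swap i j d) := by
    intro a d had hne
    rw [Equiv.swap_comm]
    exact lt_of_lt_swap hπ had hne
  have hsymm : ∀ a, (Equiv.swap i j * π).symm a = π.symm (Equiv.swap i j a) := fun a => rfl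
  by_cases hc : ∃ b, P.Visits j Side.west b ∧ P.Visits i Side.south b ∧ b ∉ P.crossings
  · obtain ⟨b₂, ⟨hj, hi, hb₂⟩, hmax⟩ := Set.exists_max_image
      {b | P.Visits j Side.west b ∧ P.Visits i Side.south b ∧ b ∉ P.crossings} diag
      ((finite_shape n).subset fun b hb => hb.1.mem_shape.1) hc
    -- At `b₂` the larger pipe `j` is northwest of `i`, so the two have already crossed.
    obtain ⟨b₁, hb₁, hd⟩ := exists_horizontalCross_of_edgeRank_lt hij hi hj rfl
      (by simp [edgeRank])
    have hf : P.CrossThenContact i j b₁ b₂ := ⟨hd, hb₁, hj, hi, hb₂⟩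
    refine ⟨P.flip b₁ b₂ hf.shape, fun k => hf.exitsAt_flip (h.exitsAt k),
      hf.ncard_flip.trans_le h.ncard_le, ?_⟩
    rintro a d ⟨b, ⟨ha, hb⟩, ⟨hd₀, -⟩⟩
    have ha' := hf.visits_of_visits_flip ha
    have hd' := hf.visits_of_visits_flip hd₀
    simp only at ha' hd'
    replace hb : b ∉ (P.flip b₁ b₂ hf.shape).crossings := hb
    rw [hsymm, hsymm]
    by_cases h₁ : b = b₁
    · subst h₁
      rw [flipPerm_left, Equiv.Perm.one_apply] at ha' hd'
      obtain rfl := Visits.injective ha' hb₁.2.1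
      obtain rfl := Visits.injective hd' hb₁.2.2
      rw [Equiv.swap_apply_left, Equiv.swap_apply_right, Fin.lt_def]
      omega
    have h₂ : b ≠ b₂ := by
      rintro rfl
      exact hb hf.right_mem_flip
    rw [hf.mem_flip h₁ h₂] at hb
    have hlt := h.linear.lt_of_contact ha' hd' hb
    by_cases hmid : diag b₁ < diag b ∧ diag b ≤ diag b₂
    · rwa [flipPerm, if_pos hmid] at hlt
    · rw [flipPerm, if_neg hmid, Equiv.Perm.one_apply, Equiv.Perm.one_apply] at hlt
      rw [flipPerm, if_neg hmid, Equiv.Perm.one_apply] at ha' hd'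
      -- Outside the exchanged portion, an arc from `j` to `i` cannot come after `b₂`, the last such
      -- contact. Nor can it come at or before `b₁`, as it would need a crossing of `i` and `j`
      -- earlier than `b₁`.
      refine hswap hlt ?_
      rintro ⟨rfl, rfl⟩
      have hle := hmax b ⟨ha', hd', hb⟩
      obtain ⟨e, he, hde⟩ := exists_horizontalCross_of_edgeRank_lt hij hd' ha' rfl
        (by simp [edgeRank])
      have := h.isReduced.eq_of_cross hij.ne (Or.inl he) (Or.inl hb₁)
      subst this
      omega
  · refine ⟨P, h.exitsAt, h.ncard_le, ?_⟩
    rintro a d ⟨b, ⟨ha, hb⟩, ⟨hd, -⟩⟩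
    rw [hsymm, hsymm]
    refine hswap (h.linear.lt_of_contact ha hd hb) ?_
    rintro ⟨rfl, rfl⟩
    exact hc ⟨b, ha, hd, hb⟩

end Filling

/-! ### The left-justified pipe dream -/

/-- The number of values `l ≥ r` which appear before `k` in the one-line notation of `ω`. -/
def countBefore {n : ℕ} (ω : Equiv.Perm (Fin n)) (r : ℕ) (k : Fin n) : ℕ :=
  (Finset.univ.filter fun l : Fin n => r ≤ l ∧ ω.symm l < ω.symm k).card

section countBefore

variable {n : ℕ} {ω : Equiv.Perm (Fin n)} {r : ℕ} {a k : Fin n}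

theorem countBefore_mono (h : ω.symm a ≤ ω.symm k) : countBefore ω r a ≤ countBefore ω r k := by
  refine Finset.card_le_card fun l => ?_
  simp only [Finset.mem_filter_univ]
  exact fun hl => ⟨hl.1, hl.2.trans_le h⟩

theorem countBefore_strictMono (hr : r ≤ a) (h : ω.symm a < ω.symm k) :
    countBefore ω r a < countBefore ω r k := by
  refine Finset.card_lt_card ⟨fun l => ?_, fun hl => ?_⟩
  · simp only [Finset.mem_filter_univ]
    exact fun hl => ⟨hl.1, hl.2.trans h⟩
  · have : a ∈ Finset.univ.filter fun l : Fin n => r ≤ l ∧ ω.symm l < ω.symm a :=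
      hl (by simp only [Finset.mem_filter_univ]; exact ⟨hr, h⟩)
    simp at this

theorem countBefore_of_lt (h : ω.symm a < ω.symm k) :
    countBefore ω a k = countBefore ω (a + 1) k + 1 := by
  unfold countBefore
  rw [← Finset.card_insert_of_notMem (a := a) (by simp)]
  congr 1
  ext l
  simp only [Finset.mem_filter_univ, Finset.mem_insert]
  constructor
  · rintro ⟨h1, h2⟩
    by_cases hl : l = a
    · exact Or.inl hl
    · have : (l : ℕ) ≠ a := fun h => hl (Fin.ext h)
      exact Or.inr ⟨by omega, h2⟩
  · rintro (rfl | ⟨h1, h2⟩)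
    · exact ⟨le_rfl, h⟩
    · exact ⟨by omega, h2⟩

theorem countBefore_of_not_lt (h : ¬ ω.symm a < ω.symm k) :
    countBefore ω a k = countBefore ω (a + 1) k := by
  unfold countBefore
  congr 1
  ext l
  simp only [Finset.mem_filter_univ]
  constructor
  · rintro ⟨h1, h2⟩
    have : (l : ℕ) ≠ a := fun hl => h (by rwa [← Fin.ext hl])
    exact ⟨by omega, h2⟩
  · rintro ⟨h1, h2⟩
    exact ⟨by omega, h2⟩

theorem countBefore_zero : countBefore ω 0 k = ω.symm k := by
  have : (Finset.univ.filter fun l : Fin n => 0 ≤ (l : ℕ) ∧ ω.symm l < ω.symm k) =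
      (Finset.Iio (ω.symm k)).map ω.toEmbedding := by
    ext l
    simp only [Finset.mem_filter_univ, Finset.mem_map_equiv, Finset.mem_Iio]
    simp
  rw [countBefore, this, Finset.card_map, Fin.card_Iio]

theorem countBefore_add_le : countBefore ω (k + 1) k + k + 1 ≤ n := by
  have h1 : countBefore ω (k + 1) k ≤ (Finset.Ioi k).card := by
    refine Finset.card_le_card fun l => ?_
    simp only [Finset.mem_filter_univ, Finset.mem_Ioi, Fin.lt_def]
    omega
  rw [Fin.card_Ioi] at h1
  have := k.2
  omega

end countBefore

namespace Filling

variable {n : ℕ} (ω : Equiv.Perm (Fin n)) {r c : ℕ} {k : Fin n} {s : Side} {b : Box}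

/-- The filling whose crossings are left-justified, with in each row the number of inversions of `ω`
whose smallest value is the entering pipe. -/
def leftJustified : Filling n where
  crossings := {b | ∃ k : Fin n, (k : ℕ) = b.1 ∧ b.2 < countBefore ω (k + 1) k}
  mem_shape := by
    rintro ⟨r, c⟩ ⟨k, rfl, h⟩
    have := countBefore_add_le (ω := ω) (k := k)
    simp only at *
    omega

variable {ω}

theorem mem_leftJustified : ((k : ℕ), c) ∈ (leftJustified ω).crossings ↔
    c < countBefore ω (k + 1) k := by
  constructor
  · rintro ⟨k', hk, h⟩
    rwa [Fin.ext hk] at h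
  · exact fun h => ⟨k, rfl, h⟩

variable (ω) in
/-- The edges visited by the pipe `k` in the left-justified filling. -/
def LeftJustifiedEdge (k : Fin n) : Side → Box → Prop
  | Side.south, b => b.1 < k ∧ b.2 = countBefore ω (b.1 + 1) k
  | Side.west, b => (b.1 = k ∧ b.2 ≤ countBefore ω (k + 1) k) ∨
      ∃ a : Fin n, (a : ℕ) = b.1 ∧ a < k ∧ b.2 = countBefore ω (a + 1) k + 1 ∧ ω.symm a < ω.symm k

theorem LeftJustifiedEdge.north_of_west (h : LeftJustifiedEdge ω k Side.west (r, c))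
    (hc : (r, c) ∉ (leftJustified ω).crossings) : r ≤ k ∧ c = countBefore ω r k := by
  rcases h with ⟨rfl, h⟩ | ⟨a, rfl, hak, rfl, h⟩
  · rw [mem_leftJustified] at hc
    rw [countBefore_of_not_lt (lt_irrefl _)]
    exact ⟨le_rfl, by simp only at h; omega⟩
  · exact ⟨le_of_lt hak, (countBefore_of_lt h).symm⟩

theorem LeftJustifiedEdge.north_of_south (h : LeftJustifiedEdge ω k Side.south (r, c))
    (hc : (r, c) ∈ (leftJustified ω).crossings) : r ≤ k ∧ c = countBefore ω r k := by
  obtain ⟨hr, hcount⟩ := h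
  obtain ⟨a, rfl, ha⟩ := hc
  simp only at hr hcount ha
  subst hcount
  refine ⟨le_of_lt hr, (countBefore_of_not_lt fun h => ?_).symm⟩
  exact absurd ha (not_lt.2 (countBefore_mono h.le))

theorem LeftJustifiedEdge.row_eq (h : LeftJustifiedEdge ω k Side.west (r, c))
    (hc : (r, c) ∈ (leftJustified ω).crossings) : r = k ∧ c < countBefore ω (k + 1) k := by
  rcases h with ⟨rfl, h⟩ | ⟨a, rfl, hak, rfl, h⟩
  · exact ⟨rfl, mem_leftJustified.1 hc⟩
  · rw [mem_leftJustified] at hc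
    have := countBefore_mono (r := a + 1) h.le
    omega

/-- The rows from `r` down sort the pipes `≥ r` in their order in `ω`. When row `a` is added, the
pipes before `a` in `ω` go straight up through its crossings, and those after `a` are shifted one
column east. -/
theorem Visits.leftJustifiedEdge (h : (leftJustified ω).Visits k s b) :
    LeftJustifiedEdge ω k s b := by
  unfold Visits at h
  induction h with
  | enter => exact Or.inl ⟨rfl, Nat.zero_le _⟩
  | westNorth r c _ hm ih =>
    have := ih.north_of_west hm
    exact ⟨this.1, this.2⟩
  | westEast r c _ hm ih =>
    have := ih.row_eq (by simpa using hm)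
    exact Or.inl ⟨this.1, this.2⟩
  | southEast r c _ hm ih =>
    obtain ⟨hr, hc⟩ := ih
    simp only at hr hc
    have hr' : r < n := hr.trans k.2
    have hm : ((⟨r, hr'⟩ : Fin n).val, c) ∉ (leftJustified ω).crossings := hm
    rw [mem_leftJustified] at hm
    refine Or.inr ⟨⟨r, hr'⟩, rfl, hr, by simp [hc], ?_⟩
    by_contra hlt
    have hne : (⟨r, hr'⟩ : Fin n) ≠ k := fun h => by simp [← h] at hr
    refine hm (hc ▸ countBefore_strictMono hr (lt_of_le_of_ne (not_lt.1 hlt) ?_))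
    exact fun h => hne (ω.symm.injective h).symm
  | southNorth r c _ hm ih =>
    have := ih.north_of_south (by simpa using hm)
    exact ⟨this.1, this.2⟩

theorem exitsAt_leftJustified (k : Fin n) : ExitsAt ((leftJustified ω).pipe k) (ω.symm k) := by
  have key : ∀ k', (ω.symm k : ℕ) = countBefore ω 0 k' → k' = k := fun k' h => by
    rw [countBefore_zero] at h
    exact (ω.symm.injective (Fin.ext h)).symm
  by_cases hc : ((0, (ω.symm k : ℕ)) : Box) ∈ (leftJustified ω).crossings
  · obtain ⟨k', hk'⟩ := exists_visits_south ((leftJustified ω).mem_shape _ hc)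
    obtain rfl := key k' (hk'.leftJustifiedEdge.north_of_south hc).2
    exact Or.inr (mem_pipe_southNorth.2 ⟨hk', hc⟩)
  · obtain ⟨k', hk'⟩ := exists_visits_west (P := leftJustified ω)
      (b := (0, (ω.symm k : ℕ))) (by simp)
    obtain rfl := key k' (hk'.leftJustifiedEdge.north_of_west hc).2
    exact Or.inl (mem_pipe_westNorth.2 ⟨hk', hc⟩)

/-- At a contact, the column equals the count of the southern pipe `d` and is at least the count of
the western pipe `a`; were `d` before `a` in `ω`, its count would be strictly smaller. -/
theorem isLinearExtension_leftJustified : (leftJustified ω).IsLinearExtension ω := by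
  rintro a d ⟨⟨r, c⟩, ⟨ha, hb⟩, ⟨hd, -⟩⟩
  have hne : d ≠ a := by
    rintro rfl
    exact absurd (ha.eq_of_diag_eq hd rfl).1 (by simp)
  obtain ⟨hr, hc⟩ := Visits.leftJustifiedEdge hd
  simp only at hr hc
  by_contra hlt
  have hlt : ω.symm d < ω.symm a :=
    lt_of_le_of_ne (not_lt.1 hlt) fun h => hne (ω.symm.injective h)
  have h1 := countBefore_strictMono (r := r + 1) hr hlt
  rcases Visits.leftJustifiedEdge ha with ⟨h2, -⟩ | ⟨a', h2, -, h3, -⟩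
  · simp only at h2
    subst h2
    have : ¬ c < countBefore ω (a + 1) a := fun h => hb (mem_leftJustified.2 h)
    omega
  · simp only at h2 h3
    subst h2
    omega

/-- Each crossing is between the pipe entering in its row and a larger pipe preceding it in `ω`;
this inversion determines the box. -/
theorem ncard_leftJustified : (leftJustified ω).crossings.ncard ≤ (inversions ω).ncard := by
  have hsub : (leftJustified ω).crossings ⊆
      (fun p : Fin n × Fin n => ((p.1 : ℕ), countBefore ω (p.1 + 1) p.2)) '' inversions ω := by
    rintro ⟨r, c⟩ hb
    have hsh := (leftJustified ω).mem_shape _ hb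
    obtain ⟨a, ha⟩ := exists_visits_west (P := leftJustified ω) (b := (r, c)) (by omega)
    obtain ⟨d, hd⟩ := exists_visits_south (P := leftJustified ω) (b := (r, c)) hsh
    obtain ⟨rfl, h1⟩ := ha.leftJustifiedEdge.row_eq hb
    obtain ⟨h2, h3⟩ := hd.leftJustifiedEdge
    simp only at h2 h3
    refine ⟨(a, d), ⟨h2, ?_⟩, by rw [h3]⟩
    by_contra hlt
    have := countBefore_mono (r := a + 1) (not_lt.1 hlt)
    simp only at this
    omega
  exact (Set.ncard_le_ncard hsub (Set.toFinite _)).trans (Set.ncard_image_le (Set.toFinite _))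

/-! ### Existence by descent in weak order -/

/-- If `π ≤ ω` in the weak order, there is a minimal pipe dream with exiting permutation `ω` and
linear extension `π`. -/
theorem exists_isMinimalDream (π : Equiv.Perm (Fin n)) (hπ : WeakLE π ω) :
    ∃ P : Filling n, P.IsMinimalDream π ω := by
  obtain ⟨m, hm⟩ : ∃ m, (inversions ω \ inversions π).ncard = m := ⟨_, rfl⟩
  induction m using Nat.strong_induction_on generalizing π with
  | _ m ih =>
  by_cases hmono : StrictMono fun t => ω.symm (π t)
  · refine ⟨leftJustified ω, exitsAt_leftJustified, ncard_leftJustified, fun a d had => ?_⟩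
    have := isLinearExtension_leftJustified a d had
    rw [← hmono.lt_iff_lt]
    simpa using this
  -- Some consecutive entries of `π` are in the opposite order in `ω`. They are increasing by `π ≤
  -- ω`, so exchanging them goes up in weak order while staying below `ω`.
  · obtain ⟨i, j, hπij, hω⟩ : ∃ i j, (π.symm i : ℕ) + 1 = π.symm j ∧ ω.symm j < ω.symm i := by
      cases n with
      | zero => exact absurd (fun a => a.elim0) hmono
      | succ n =>
        rw [Fin.strictMono_iff_lt_succ] at hmono
        push Not at hmono
        obtain ⟨t, ht⟩ := hmono
        refine ⟨π t.castSucc, π t.succ, by simp, lt_of_le_of_ne ht fun h => ?_⟩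
        have := π.injective (ω.symm.injective h)
        exact absurd this (Fin.castSucc_lt_succ).ne'
    have hne : i ≠ j := by rintro rfl; omega
    have hij : i < j := by
      by_contra h
      have := hπ j i (lt_of_le_of_ne (not_lt.1 h) hne.symm) (by rw [Fin.lt_def]; omega)
      exact lt_asymm this hω
    have hsymm : ∀ a, (Equiv.swap i j * π).symm a = π.symm (Equiv.swap i j a) := fun a => rfl
    have hij' : (Equiv.swap i j * π).symm j = π.symm i := by
      rw [hsymm, Equiv.swap_apply_right]
    have hji' : (Equiv.swap i j * π).symm i = π.symm j := by
      rw [hsymm, Equiv.swap_apply_left]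
    have hle : WeakLE (Equiv.swap i j * π) ω := by
      intro a d had h
      by_cases hc : d = j ∧ a = i
      · obtain ⟨rfl, rfl⟩ := hc
        exact hω
      · have h1 := lt_of_lt_swap (p := (Equiv.swap i j * π).symm) (i := j) (j := i)
          (by rw [hij', hji']; exact hπij) h hc
        rw [hsymm, hsymm, Equiv.swap_comm j i, Equiv.swap_apply_self, Equiv.swap_apply_self] at h1
        exact hπ a d had h1
    have hsub : inversions ω \ inversions (Equiv.swap i j * π) ⊂ inversions ω \ inversions π := by
      refine ⟨?_, fun hs => ?_⟩
      · rintro ⟨a, d⟩ ⟨h1, h2⟩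
        refine ⟨h1, fun h3 => h2 ⟨h3.1, ?_⟩⟩
        simp only [hsymm]
        refine lt_of_lt_swap hπij h3.2 ?_
        rintro ⟨rfl, rfl⟩
        exact lt_asymm hij h3.1
      · have h1 : (i, j) ∈ inversions ω \ inversions π := by
          refine ⟨⟨hij, hω⟩, fun h => ?_⟩
          have := h.2
          simp only [Fin.lt_def] at this
          omega
        refine (hs h1).2 ⟨hij, ?_⟩
        simp only [hij', hji', Fin.lt_def]
        omega
    obtain ⟨P, hP⟩ := ih _ (hm ▸ Set.ncard_lt_ncard hsub (Set.toFinite _)) _ hle rfl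
    -- Exchanging `i` and `j` once more comes back to `π`.
    obtain ⟨Q, hQ⟩ := hP.exists_swap hij (by rw [hij', hji']; exact hπij)
    rw [← mul_assoc, Equiv.swap_mul_self, one_mul] at hQ
    exact ⟨Q, hQ⟩

end Filling

/-! ### The proposition -/

theorem proposition4p3 (n : ℕ) (π ω : Equiv.Perm (Fin n)) (hπω : WeakLE π ω) :
    ∃ P : Filling n,
      (P.IsPipeDream ω ∧ P.IsAcyclic ∧ P.IsLinearExtension π) ∧
      (∀ Q : Filling n,
        Q.IsPipeDream ω ∧ Q.IsAcyclic ∧ Q.IsLinearExtension π → Q = P) ∧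
      (∀ i : Fin n, insertionDrawing π ω n i = P.pipe i) ∧
      ∀ t : Fin n,
        let j : ℕ := (π t : ℕ)
        let c : ℕ := (ω.symm (π t) : ℕ)
        let D := insertionDrawing π ω t
        let E := freeElbowsIn D j c
        let p := insertionDrawing π ω (t + 1) (π t)
        IsStaircase E ∧ (∀ e ∈ E, e.1 < j ∧ e.2 < c) ∧
        EntersAt p j ∧ ExitsAt p c ∧
        (∀ b : Box, (b, Piece.southEast) ∈ p ↔ b ∈ E) ∧
        (∀ A B : Set Box,
          ExitsAt (tracedPipe A B j) c →
          (∀ b : Box, (b, Piece.southEast) ∈ tracedPipe A B j → b ∈ freeElbows D) →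
          ∀ x ∈ tracedPipe A B j, ∃ y ∈ p, y.1.1 ≤ x.1.1 ∧ y.1.2 ≤ x.1.2) := by
  obtain ⟨P, hmin⟩ := Filling.exists_isMinimalDream π hπω
  have hP : P.IsPipeDream ω := ⟨hmin.isReduced, hmin.exitsAt⟩
  have hl := hmin.linear
  refine ⟨P, ⟨hP, hl.isAcyclic, hl⟩, fun Q hQ => ?_, Filling.insertionDrawing_eq_pipe hP hl,
    fun t => ?_⟩
  · refine Filling.eq_of_pipe_eq fun i => ?_
    rw [← Filling.insertionDrawing_eq_pipe hP hl, Filling.insertionDrawing_eq_pipe hQ.1 hQ.2.2]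
  · have hx := hP.2 (π t)
    have hE := Filling.freeElbowsIn_partialDrawing hl hP.1 hx
    rw [Equiv.symm_apply_apply] at hE
    have hp : insertionDrawing π ω (t + 1) (π t) = P.pipe (π t) := by
      rw [Filling.insertionDrawing_eq hP hl _ t.2]
      simp [Filling.partialDrawing]
    rw [← Filling.insertionDrawing_eq hP hl t t.2.le] at hE
    intro j c D E p
    have hE' : E = {b | (b, Piece.southEast) ∈ P.pipe (π t)} := hE
    have hp' : p = P.pipe (π t) := hp
    have henter : EntersAt p j := by
      rw [hp']
      by_cases h : ((π t : ℕ), 0) ∈ P.crossings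
      · exact Or.inr (Filling.mem_pipe_westEast.2 ⟨Arrives.enter, h⟩)
      · exact Or.inl (Filling.mem_pipe_westNorth.2 ⟨Arrives.enter, h⟩)
    have hexit : ExitsAt p c := by rwa [hp']
    refine ⟨?_, ?_, henter, hexit, ?_, ?_⟩
    · rw [hE']
      exact isStaircase_southEast
    · rw [hE']
      rintro ⟨r, d⟩ ⟨h1, h2⟩
      have h3 := (Arrives.southEast r d h1 h2).col_le_of_exitsAt hx
      -- Arriving from the south means coming from row `r + 1 ≤ j`, which makes the row bound
      -- strict; the step east made the column bound strict.
      cases h1 with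
      | westNorth _ _ h1 _ | southNorth _ _ h1 _ => exact ⟨h1.row_le, h3⟩
    · intro b
      rw [hp', hE']
      rfl
    · intro A B hAB hfree x hx'
      refine exists_northwest_of_southEast_subset hAB henter hexit (fun b hb => ?_) hx'
      -- A path with these ends stays in the rectangle, so its turns to the east are among those of
      -- `p`.
      have hbE : b ∈ E := ⟨hfree b hb, Arrives.row_le hb.1, Arrives.col_le_of_exitsAt hAB hb.1⟩
      rw [hE'] at hbE
      rw [hp']
      exact hbE
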